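/- Let $n\ge 1$ be an integer. For $1\le p<\infty$, $0\le\lambda\le n$ and a measurable function $f$ on $\mathbb{R}^n$ put $$\mathfrak{M}_{p,\lambda}(f;x,r)=\frac1{r^{\lambda}}\int_{B(x,r)}|f(y)|^p\,dy,\qquad x\in\mathbb{R}^n,\ r>0,\qquad \|f\|_{p,\lambda}=\sup_{x\in\mathbb{R}^n,\,r>0}\mathfrak{M}_{p,\lambda}(f;x,r)^{1/p},$$ where $B(x,r)$ is the open Euclidean ball. The Morrey space $L^{p,\lambda}(\mathbb{R}^n)$ consists of all $f$ with $\|f\|_{p,\lambda}<\infty$, and $V_\infty L^{p,\lambda}(\mathbb{R}^n)$ consists of all $f\in L^{p,\lambda}(\mathbb{R}^n)$ with $$\lim_{r\to\infty}\ \sup_{x\in\mathbb{R}^n}\mathfrak{M}_{p,\lambda}(f;x,r)=0 .$$ For $0<\alpha<n$ consider the Riesz potential operator, the fractional maximal operator and the two Hardy operators $$I^\alpha f(x)=\int_{\mathbb{R}^n}\frac{f(y)}{|x-y|^{n-\alpha}}\,dy,\qquad M^\alpha f(x)=\sup_{t>0}\frac1{|B(x,t)|^{1-\alpha/n}}\int_{B(x,t)}|f(y)|\,dy,$$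 $$H^\alpha f(x)=|x|^{\alpha-n}\int_{|y|<|x|}f(y)\,dy,\qquad \mathcal{H}^\alpha f(x)=|x|^{\alpha}\int_{|y|>|x|}\frac{f(y)}{|y|^n}\,dy .$$ **Theorem.** Let $0<\alpha<n$, $1<p<n/\alpha$, $0\le\lambda<n-\alpha p$, $1/q=1/p-\alpha/n$ and $\lambda/p=\mu/q$. Let $T^\alpha$ be any of the operators $I^\alpha$, $M^\alpha$, $H^\alpha$, $\mathcal{H}^\alpha$. Then $T^\alpha$ is bounded from $V_\infty L^{p,\lambda}(\mathbb{R}^n)$ into $V_\infty L^{q,\mu}(\mathbb{R}^n)$: there is a constant $C<\infty$, depending only on $n,\alpha,p,\lambda$, such that for every complex-valued $f\in V_\infty L^{p,\lambda}(\mathbb{R}^n)$ the value $T^\alpha f(x)$ is well defined for almost every $x$ (the defining integral converges absolutely, respectively the supremum is finite), $T^\alpha f\in V_\infty L^{q,\mu}(\mathbb{R}^n)$, and $$\|T^\alpha f\|_{q,\mu}\le C\,\|f\|_{p,\lambda}.$$ -/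

import Mathlib

open MeasureTheory Filter Topology
open scoped ENNReal NNReal

noncomputable section

/-- The modular `r ^ (-lam) * ∫_{B(x,r)} |f y| ^ p dy`, as an element of `[0,∞]` (used for `r > 0`).
The codomain `F` is `ℂ`, or `[0,∞]` for maximal functions (where `‖a‖ₑ = a`). -/
def morreyModular {n : ℕ} {F : Type*} [ENorm F] (p lam : ℝ)
    (f : EuclideanSpace ℝ (Fin n) → F) (x : EuclideanSpace ℝ (Fin n)) (r : ℝ) : ℝ≥0∞ :=
  (∫⁻ y in Metric.ball x r, ‖f y‖ₑ ^ p) / ENNReal.ofReal (r ^ lam)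

/-- The Morrey norm, the supremum over `x` and `r > 0` of the modular to the power `1 / p`;
it takes the value `∞` outside the Morrey space. -/
def morreyNorm {n : ℕ} {F : Type*} [ENorm F] (p lam : ℝ)
    (f : EuclideanSpace ℝ (Fin n) → F) : ℝ≥0∞ :=
  ⨆ (x : EuclideanSpace ℝ (Fin n)) (r : ℝ) (_ : 0 < r), morreyModular p lam f x r ^ (1 / p)

/-- Membership in the Morrey space `L^{p,lam}`. Local `p`-integrability is contained in the
finiteness of the norm, since the modulars over all balls are then finite. -/
def MemMorrey {n : ℕ} {F : Type*} [ENorm F] [TopologicalSpace F] (p lam : ℝ)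
    (f : EuclideanSpace ℝ (Fin n) → F) : Prop :=
  AEStronglyMeasurable f volume ∧ morreyNorm p lam f < ∞

/-- Membership in the Morrey space `V_∞ L^{p,lam}` vanishing at infinity. -/
def MemVanishingMorrey {n : ℕ} {F : Type*} [ENorm F] [TopologicalSpace F] (p lam : ℝ)
    (f : EuclideanSpace ℝ (Fin n) → F) : Prop :=
  MemMorrey p lam f ∧
    Tendsto (fun r : ℝ => ⨆ x : EuclideanSpace ℝ (Fin n), morreyModular p lam f x r) atTop (𝓝 0)

/-- The operator `T` maps `V_∞ L^{p,lam}` into `V_∞ L^{q,mu}`, and is bounded in Morrey norm. -/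
def BoundedOnVanishingMorrey {n : ℕ} {F : Type*} [ENorm F] [TopologicalSpace F]
    (T : (EuclideanSpace ℝ (Fin n) → ℂ) → EuclideanSpace ℝ (Fin n) → F)
    (p lam q mu : ℝ) : Prop :=
  ∃ C : ℝ≥0, ∀ f : EuclideanSpace ℝ (Fin n) → ℂ, MemVanishingMorrey p lam f →
    MemVanishingMorrey q mu (T f) ∧ morreyNorm q mu (T f) ≤ C * morreyNorm p lam f

/-- The Riesz potential operator `I^α`. -/
def rieszPotential {n : ℕ} (α : ℝ) (f : EuclideanSpace ℝ (Fin n) → ℂ)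
    (x : EuclideanSpace ℝ (Fin n)) : ℂ :=
  ∫ y, f y / ((‖x - y‖ ^ ((n : ℝ) - α) : ℝ) : ℂ)

/-- The fractional maximal operator `M^α`, with values in `[0,∞]`. -/
def fractionalMaximal {n : ℕ} (α : ℝ) (f : EuclideanSpace ℝ (Fin n) → ℂ)
    (x : EuclideanSpace ℝ (Fin n)) : ℝ≥0∞ :=
  ⨆ (t : ℝ) (_ : 0 < t),
    (∫⁻ y in Metric.ball x t, ‖f y‖ₑ) / volume (Metric.ball x t) ^ (1 - α / (n : ℝ))

/-- The Hardy operator `H^α`. -/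
def hardyInner {n : ℕ} (α : ℝ) (f : EuclideanSpace ℝ (Fin n) → ℂ)
    (x : EuclideanSpace ℝ (Fin n)) : ℂ :=
  ((‖x‖ ^ (α - (n : ℝ)) : ℝ) : ℂ) * ∫ y in {y | ‖y‖ < ‖x‖}, f y

/-- The Hardy operator `𝓗^α`. -/
def hardyOuter {n : ℕ} (α : ℝ) (f : EuclideanSpace ℝ (Fin n) → ℂ)
    (x : EuclideanSpace ℝ (Fin n)) : ℂ :=
  ((‖x‖ ^ α : ℝ) : ℂ) * ∫ y in {y | ‖x‖ < ‖y‖}, f y / ((‖y‖ ^ n : ℝ) : ℂ)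

end

/-!
All four operators are dominated pointwise almost everywhere by one object, the Riesz potential
`rieszLIntegral` of `‖f‖`, with values in `[0,∞]`: the kernel `‖x - y‖ ^ (α - n)` is at least
`t ^ (α - n)` on the ball of radius `t` about `x`, at least `(2 * ‖x‖) ^ (α - n)` where
`‖y‖ < ‖x‖`, and at least `(2 * ‖y‖) ^ (α - n)` where `‖x‖ < ‖y‖`. Absolute convergence, finiteness
and boundedness of the operators therefore all follow from an estimate for this potential.

The estimate is local (`exists_lintegral_ball_rieszLIntegral_rpow_le`): if the modulars of `f` of
exponent `p` are at most `K` at all radii `s ≥ r`, then the modulars of the potential of exponent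
`q` at the radius `r` are at most `C * K ^ (q / p)`. Taking `K = ‖f‖ ^ p` gives the norm bound.
Since only radii `s ≥ r` enter, modulars that vanish uniformly as `r → ∞` are mapped to modulars
with the same property.

To prove it, split `f` at the ball of radius `2 * r`. The inner part is handled by the
Hardy–Littlewood–Sobolev inequality from `L^p` to `L^q`. For the outer part, write the kernel as an
integral over radii (`rieszLIntegral_eq_lintegral_ball`),
`J g x = (n - α) * ∫_0^∞ s ^ (α - n - 1) * (∫_{B(x,s)} g) ds`.
On the ball of radius `r` only `s > r` contributes, Hölder's inequality bounds the inner integral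
by a power of `s`, and the integral over `s` converges because `lam < n - α * p`.

The Hardy–Littlewood–Sobolev inequality comes from Hedberg's pointwise bound: in the same formula
the radii below `R` are estimated by the maximal function, those above `R` by Hölder's inequality,
and `R` is optimised. The `L^p` bound for the maximal function follows from its weak type `(1,1)`
bound, a consequence of the Vitali covering lemma, by the layer cake formula.
-/

/-! ### Power integrals on the half-line -/

section PowerIntegrals

lemma lintegral_Ioo_ofReal_rpow {a r : ℝ} (ha : -1 < a) (hr : 0 ≤ r) :
    ∫⁻ s in Set.Ioo 0 r, ENNReal.ofReal s ^ a
      = ENNReal.ofReal (a + 1)⁻¹ * ENNReal.ofReal r ^ (a + 1) := by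
  have h1 : ∫⁻ s in Set.Ioo 0 r, ENNReal.ofReal s ^ a
      = ∫⁻ s in Set.Ioo 0 r, ENNReal.ofReal (s ^ a) :=
    setLIntegral_congr_fun measurableSet_Ioo fun s hs ↦ ENNReal.ofReal_rpow_of_pos hs.1
  have hint : IntegrableOn (fun s : ℝ ↦ s ^ a) (Set.Ioc 0 r) :=
    (intervalIntegrable_iff_integrableOn_Ioc_of_le hr).1
      (intervalIntegral.intervalIntegrable_rpow' ha)
  rw [h1, ← setLIntegral_congr Ioo_ae_eq_Ioc.symm, ← ofReal_integral_eq_lintegral_ofReal hint,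
    ← intervalIntegral.integral_of_le hr, integral_rpow (Or.inl ha),
    Real.zero_rpow (by linarith), sub_zero, ENNReal.ofReal_rpow_of_nonneg hr (by linarith),
    ← ENNReal.ofReal_mul (by rw [inv_nonneg]; linarith), div_eq_inv_mul]
  filter_upwards [ae_restrict_mem measurableSet_Ioc] with s hs
  exact Real.rpow_nonneg hs.1.le _

/-- For `r = 0` both sides are `∞`. -/
lemma lintegral_Ioi_ofReal_rpow {a r : ℝ} (ha : a < -1) (hr : 0 ≤ r) :
    ∫⁻ s in Set.Ioi r, ENNReal.ofReal s ^ a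
      = ENNReal.ofReal (-(a + 1))⁻¹ * ENNReal.ofReal r ^ (a + 1) := by
  have key : ∀ r : ℝ, 0 < r → ∫⁻ s in Set.Ioi r, ENNReal.ofReal s ^ a
      = ENNReal.ofReal (-(a + 1))⁻¹ * ENNReal.ofReal r ^ (a + 1) := by
    intro r hr
    have h1 : ∫⁻ s in Set.Ioi r, ENNReal.ofReal s ^ a
        = ∫⁻ s in Set.Ioi r, ENNReal.ofReal (s ^ a) :=
      setLIntegral_congr_fun measurableSet_Ioi fun s hs ↦
        ENNReal.ofReal_rpow_of_pos (hr.trans hs)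
    rw [h1, ← ofReal_integral_eq_lintegral_ofReal (integrableOn_Ioi_rpow_of_lt ha hr),
      integral_Ioi_rpow_of_lt ha hr, ENNReal.ofReal_rpow_of_pos hr,
      ← ENNReal.ofReal_mul (by rw [inv_nonneg]; linarith)]
    · congr 1
      have : a + 1 ≠ 0 := by linarith
      field_simp
    · filter_upwards [ae_restrict_mem measurableSet_Ioi] with s hs
      exact Real.rpow_nonneg (hr.trans hs).le _
  rcases hr.eq_or_lt with rfl | hr
  · have hc : ENNReal.ofReal (-(a + 1))⁻¹ ≠ 0 := by
      rw [Ne, ENNReal.ofReal_eq_zero, not_le, inv_pos]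
      linarith
    rw [ENNReal.ofReal_zero, ENNReal.zero_rpow_of_neg (by linarith), ENNReal.mul_top hc]
    -- the integral over `Ioi 0` dominates the integrals over all `Ioi r`, which tend to `∞`
    have hlim : Tendsto (fun r : ℝ ↦ ENNReal.ofReal (-(a + 1))⁻¹ * ENNReal.ofReal r ^ (a + 1))
        (𝓝[>] 0) (𝓝 ∞) := by
      have h1 : Tendsto (fun r : ℝ ↦ ENNReal.ofReal r ^ (a + 1)) (𝓝[>] 0) (𝓝 ∞) := by
        have h2 := (ENNReal.continuous_rpow_const (y := a + 1)).tendsto 0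
        rw [ENNReal.zero_rpow_of_neg (by linarith)] at h2
        refine h2.comp ?_
        have h3 := ENNReal.continuous_ofReal.tendsto 0
        rw [ENNReal.ofReal_zero] at h3
        exact h3.mono_left nhdsWithin_le_nhds
      have := ENNReal.Tendsto.const_mul (a := ENNReal.ofReal (-(a + 1))⁻¹) h1 (Or.inl (by simp))
      rwa [ENNReal.mul_top hc] at this
    refine top_le_iff.1 (le_of_tendsto hlim ?_)
    filter_upwards [self_mem_nhdsWithin] with r hr
    rw [← key r hr]
    exact lintegral_mono_set (Set.Ioi_subset_Ioi (le_of_lt hr))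
  · exact key r hr

/-- The layer cake formula for a single value `a ∈ [0,∞]`. -/
lemma lintegral_indicator_lt_rpow {p : ℝ} (hp : 0 < p) (a : ℝ≥0∞) :
    ∫⁻ t in Set.Ioi (0 : ℝ),
        {t : ℝ | ENNReal.ofReal t < a}.indicator (fun t ↦ ENNReal.ofReal t ^ (p - 1)) t
      = ENNReal.ofReal p⁻¹ * a ^ p := by
  have key : ∀ b : ℝ, 0 ≤ b → ∫⁻ t in Set.Ioi (0 : ℝ),
        {t : ℝ | ENNReal.ofReal t < ENNReal.ofReal b}.indicator
          (fun t ↦ ENNReal.ofReal t ^ (p - 1)) t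
      = ENNReal.ofReal p⁻¹ * ENNReal.ofReal b ^ p := by
    intro b hb
    have hm : MeasurableSet {t : ℝ | ENNReal.ofReal t < ENNReal.ofReal b} :=
      measurableSet_lt (by fun_prop) (by fun_prop)
    have hs : {t : ℝ | ENNReal.ofReal t < ENNReal.ofReal b} ∩ Set.Ioi 0 = Set.Ioo 0 b := by
      ext t
      simp only [Set.mem_inter_iff, Set.mem_ofPred_eq, Set.mem_Ioi, Set.mem_Ioo]
      constructor
      · rintro ⟨h1, h2⟩
        exact ⟨h2, (ENNReal.ofReal_lt_ofReal_iff_of_nonneg h2.le).1 h1⟩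
      · rintro ⟨h1, h2⟩
        exact ⟨(ENNReal.ofReal_lt_ofReal_iff_of_nonneg h1.le).2 h2, h1⟩
    rw [lintegral_indicator hm, Measure.restrict_restrict hm, hs,
      lintegral_Ioo_ofReal_rpow (by linarith) hb]
    simp
  by_cases ha : a = ∞
  · subst ha
    rw [ENNReal.top_rpow_of_pos hp, ENNReal.mul_top (by simpa using hp)]
    -- the integral dominates the layer cake integral of every finite value
    have hlim : Tendsto (fun b : ℝ ↦ ENNReal.ofReal p⁻¹ * ENNReal.ofReal b ^ p) atTop (𝓝 ∞) := by
      have h2 : Tendsto (fun b : ℝ ↦ ENNReal.ofReal b ^ p) atTop (𝓝 ∞) := by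
        have := (ENNReal.continuous_rpow_const (y := p)).tendsto ∞
        rw [ENNReal.top_rpow_of_pos hp] at this
        exact this.comp ENNReal.tendsto_ofReal_atTop
      have := ENNReal.Tendsto.const_mul (a := ENNReal.ofReal p⁻¹) h2 (Or.inl (by simp))
      rwa [ENNReal.mul_top (by simpa using hp)] at this
    refine top_le_iff.1 (le_of_tendsto hlim ?_)
    filter_upwards [eventually_ge_atTop 0] with b hb
    rw [← key b hb]
    refine lintegral_mono fun t ↦ Set.indicator_le_indicator_of_subset ?_ (fun _ ↦ zero_le) t
    intro t _
    exact ENNReal.ofReal_lt_top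
  · have := key a.toReal ENNReal.toReal_nonneg
    rwa [ENNReal.ofReal_toReal ha] at this

/-- The layer cake formula for a `[0,∞]`-valued function. -/
lemma lintegral_rpow_eq_lintegral_meas_lt {X : Type*} [MeasurableSpace X] (μ : Measure X)
    [SFinite μ] {g : X → ℝ≥0∞} (hg : Measurable g) {p : ℝ} (hp : 0 < p) :
    ∫⁻ x, g x ^ p ∂μ = ENNReal.ofReal p *
      ∫⁻ t in Set.Ioi (0 : ℝ), ENNReal.ofReal t ^ (p - 1) * μ {x | ENNReal.ofReal t < g x} := by
  have h1 : ∀ x, g x ^ p = ENNReal.ofReal p * ∫⁻ t in Set.Ioi (0 : ℝ),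
      {t : ℝ | ENNReal.ofReal t < g x}.indicator (fun t ↦ ENNReal.ofReal t ^ (p - 1)) t := by
    intro x
    rw [lintegral_indicator_lt_rpow hp, ← mul_assoc, ← ENNReal.ofReal_mul hp.le,
      mul_inv_cancel₀ hp.ne', ENNReal.ofReal_one, one_mul]
  have hS : MeasurableSet {z : X × ℝ | ENNReal.ofReal z.2 < g z.1} :=
    measurableSet_lt (by fun_prop) (by fun_prop)
  have hmeas : Measurable fun z : X × ℝ ↦
      {t : ℝ | ENNReal.ofReal t < g z.1}.indicator (fun t ↦ ENNReal.ofReal t ^ (p - 1)) z.2 :=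
    (Measurable.indicator (f := fun z : X × ℝ ↦ ENNReal.ofReal z.2 ^ (p - 1))
      (by fun_prop) hS)
  simp_rw [h1]
  rw [lintegral_const_mul' _ _ ENNReal.ofReal_ne_top,
    lintegral_lintegral_swap hmeas.aemeasurable]
  congr 1
  refine lintegral_congr fun t ↦ ?_
  have hSt : MeasurableSet {x | ENNReal.ofReal t < g x} := measurableSet_lt (by fun_prop) hg
  rw [← lintegral_indicator_const hSt]
  rfl

end PowerIntegrals

/-! ### The maximal function -/

section MaximalFunction

open Metric Module

lemma lowerSemicontinuous_lintegral_ball {X : Type*} [PseudoMetricSpace X]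
    [MeasurableSpace X] (μ : Measure X) (g : X → ℝ≥0∞) (t : ℝ) :
    LowerSemicontinuous fun x ↦ ∫⁻ y in ball x t, g y ∂μ := by
  intro x a hax
  change a < ∫⁻ y in ball x t, g y ∂μ at hax
  -- the integrals over the concentric smaller balls increase to the one over `ball x t`
  have hU : ⋃ k : ℕ, ball x (t - 1 / ((k : ℝ) + 1)) = ball x t := by
    ext y
    simp only [Set.mem_iUnion, mem_ball]
    constructor
    · rintro ⟨k, hk⟩
      have : 0 < 1 / ((k : ℝ) + 1) := by positivity
      linarith
    · intro hy
      obtain ⟨k, hk⟩ := exists_nat_one_div_lt (sub_pos.2 hy)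
      exact ⟨k, by linarith⟩
  have hmono : Monotone fun k : ℕ ↦ ball x (t - 1 / ((k : ℝ) + 1)) := by
    intro k l hkl
    apply ball_subset_ball
    have := Nat.one_div_le_one_div (α := ℝ) hkl
    linarith
  rw [← hU, setLIntegral_iUnion_of_directed _ hmono.directed_le, lt_iSup_iff] at hax
  obtain ⟨k, hk⟩ := hax
  have hpos : 0 < 1 / ((k : ℝ) + 1) := by positivity
  filter_upwards [ball_mem_nhds x hpos] with x' hx'
  refine hk.trans_le (lintegral_mono_set (ball_subset_ball' ?_))
  rw [mem_ball, dist_comm] at hx'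
  linarith

variable {E : Type*} [NormedAddCommGroup E] [NormedSpace ℝ E] [MeasurableSpace E]

/-- The centred maximal function of `g ≥ 0` over open balls, the integral over a ball being divided
by the power `γ` of its measure: `γ = 1` is the Hardy–Littlewood maximal function and
`γ = 1 - α / n` the fractional one. -/
noncomputable def ballMaximal (μ : Measure E) (γ : ℝ) (g : E → ℝ≥0∞) (x : E) : ℝ≥0∞ :=
  ⨆ (t : ℝ) (_ : 0 < t), (∫⁻ y in ball x t, g y ∂μ) / μ (ball x t) ^ γ

variable [FiniteDimensional ℝ E] (μ : Measure E) [μ.IsAddHaarMeasure]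

lemma lintegral_ball_le_ballMaximal (g : E → ℝ≥0∞) (x : E) {t : ℝ} (ht : 0 < t) :
    ∫⁻ y in ball x t, g y ∂μ ≤ ballMaximal μ 1 g x * μ (ball x t) := by
  have h0 : μ (ball x t) ≠ 0 := (measure_ball_pos μ _ ht).ne'
  rw [← ENNReal.div_le_iff_le_mul (Or.inl h0) (Or.inl measure_ball_lt_top.ne)]
  have := le_iSup₂ (f := fun (t : ℝ) (_ : 0 < t) ↦
    (∫⁻ y in ball x t, g y ∂μ) / μ (ball x t) ^ (1 : ℝ)) t ht
  rwa [ENNReal.rpow_one] at this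

/-- The part of `g` below the level `t` raises the maximal function by at most `t`, so only the
part above `t` contributes to the superlevel set at `2 * t`. -/
lemma ballMaximal_le_add (g : E → ℝ≥0∞) (t : ℝ≥0∞) (x : E) :
    ballMaximal μ 1 g x ≤ ballMaximal μ 1 ({y | t < g y}.indicator g) x + t := by
  refine iSup₂_le fun r hr ↦ ?_
  have h0 : μ (ball x r) ≠ 0 := (measure_ball_pos μ _ hr).ne'
  have h1 : μ (ball x r) ≠ ∞ := measure_ball_lt_top.ne
  rw [ENNReal.rpow_one, ENNReal.div_le_iff_le_mul (Or.inl h0) (Or.inl h1), add_mul]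
  calc ∫⁻ y in ball x r, g y ∂μ ≤ ∫⁻ y in ball x r, ({y | t < g y}.indicator g y + t) ∂μ := by
        refine lintegral_mono fun y ↦ ?_
        by_cases hy : t < g y
        · rw [Set.indicator_of_mem (by exact hy)]
          exact le_self_add
        · rw [Set.indicator_of_notMem (by exact hy), zero_add]
          exact not_lt.1 hy
    _ = ∫⁻ y in ball x r, {y | t < g y}.indicator g y ∂μ + t * μ (ball x r) := by
        rw [lintegral_add_right _ measurable_const, setLIntegral_const]
    _ ≤ _ := by
        gcongr
        exact lintegral_ball_le_ballMaximal μ _ x hr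

variable [BorelSpace E]

lemma measurable_ballMaximal (γ : ℝ) (g : E → ℝ≥0∞) : Measurable (ballMaximal μ γ g) := by
  refine LowerSemicontinuous.measurable ?_
  refine lowerSemicontinuous_biSup fun t ht x a hax ↦ ?_
  have h0 : μ (ball (0 : E) t) ≠ 0 := (measure_ball_pos μ _ ht).ne'
  have h1 : μ (ball (0 : E) t) ≠ ∞ := measure_ball_lt_top.ne
  have hc0 : μ (ball (0 : E) t) ^ γ ≠ 0 := by simp [ENNReal.rpow_eq_zero_iff, h0, h1]
  have hc1 : μ (ball (0 : E) t) ^ γ ≠ ∞ := by simp [ENNReal.rpow_eq_top_iff, h0, h1]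
  simp only [Measure.addHaar_ball_center μ _ t, gt_iff_lt] at hax ⊢
  rw [ENNReal.lt_div_iff_mul_lt (Or.inl hc0) (Or.inl hc1)] at hax
  filter_upwards [lowerSemicontinuous_lintegral_ball μ g t x _ hax] with y hy
  rwa [ENNReal.lt_div_iff_mul_lt (Or.inl hc0) (Or.inl hc1)]

lemma addHaar_ball_eq_ofReal_rpow (x : E) {t : ℝ} (ht : 0 < t) :
    μ (ball x t) = ENNReal.ofReal t ^ (finrank ℝ E : ℝ) * μ (ball 0 1) := by
  rw [Measure.addHaar_ball_of_pos μ x ht, ENNReal.ofReal_pow ht.le, ENNReal.rpow_natCast]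

/-- The weak type `(1,1)` inequality for the Hardy–Littlewood maximal function, by the Vitali
covering lemma. -/
theorem mul_meas_lt_ballMaximal_le [Nontrivial E] (g : E → ℝ≥0∞) (t : ℝ≥0∞) :
    t * μ {x | t < ballMaximal μ 1 g x} ≤ 5 ^ finrank ℝ E * ∫⁻ y, g y ∂μ := by
  rcases eq_or_ne t 0 with rfl | ht0
  · simp
  rcases eq_or_ne t ∞ with rfl | ht1
  · simp
  rcases eq_or_ne (∫⁻ y, g y ∂μ) ∞ with hI | hI
  · rw [hI, ENNReal.mul_top (by positivity)]
    exact le_top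
  set S := {x | t < ballMaximal μ 1 g x} with hS
  have hr : ∀ x ∈ S, ∃ r : ℝ, 0 < r ∧ t * μ (ball x r) < ∫⁻ y in ball x r, g y ∂μ := by
    intro x hx
    simp only [hS, Set.mem_ofPred_eq, ballMaximal, lt_iSup_iff, ENNReal.rpow_one] at hx
    obtain ⟨r, hr, h⟩ := hx
    exact ⟨r, hr, by rwa [ENNReal.lt_div_iff_mul_lt (Or.inl (measure_ball_pos μ _ hr).ne')
      (Or.inl measure_ball_lt_top.ne)] at h⟩
  choose! r hr0 hr using hr
  have hd : finrank ℝ E ≠ 0 := finrank_pos.ne'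
  -- the radii are bounded, as the measure of the balls is at most `t⁻¹ * ∫ g`
  obtain ⟨R, hR⟩ : ∃ R : ℝ, ∀ x ∈ S, r x ≤ R := by
    have hb : ∃ R : ℝ, 0 < R ∧ ∫⁻ y, g y ∂μ < t * μ (ball (0 : E) R) := by
      have h1 : Tendsto (fun R : ℝ ↦ t * μ (ball (0 : E) R)) atTop (𝓝 ∞) := by
        have h2 : Tendsto (fun R : ℝ ↦ t * (ENNReal.ofReal R ^ finrank ℝ E * μ (ball (0 : E) 1)))
            atTop (𝓝 ∞) := by
          have h3 := (ENNReal.continuous_pow (finrank ℝ E)).tendsto ∞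
          rw [ENNReal.top_pow hd] at h3
          have hc : μ (ball (0 : E) 1) ≠ 0 := (measure_ball_pos μ _ one_pos).ne'
          have h4 := ENNReal.Tendsto.const_mul (a := t) (ENNReal.Tendsto.mul_const
            (b := μ (ball (0 : E) 1)) (h3.comp ENNReal.tendsto_ofReal_atTop)
            (Or.inl (by simp))) (Or.inl (by simp [ENNReal.top_mul hc]))
          rwa [ENNReal.top_mul hc, ENNReal.mul_top ht0] at h4
        refine h2.congr' ?_
        filter_upwards [eventually_gt_atTop 0] with R hR
        rw [Measure.addHaar_ball_of_pos μ _ hR, ENNReal.ofReal_pow hR.le]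
      exact ((eventually_gt_atTop 0).and (h1.eventually (lt_mem_nhds hI.lt_top))).exists
    obtain ⟨R, hR0, hR⟩ := hb
    refine ⟨R, fun x hx ↦ le_of_not_gt fun hlt ↦ ?_⟩
    refine lt_irrefl (∫⁻ y, g y ∂μ) (hR.trans_le ?_)
    rw [← Measure.addHaar_ball_center μ x R]
    calc t * μ (ball x R) ≤ t * μ (ball x (r x)) := by gcongr
      _ ≤ ∫⁻ y in ball x (r x), g y ∂μ := (hr x hx).le
      _ ≤ ∫⁻ y, g y ∂μ := setLIntegral_le_lintegral _ _
  obtain ⟨u, huS, hdisj, hcov⟩ := Vitali.exists_disjoint_subfamily_covering_enlargement_closedBall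
    S (fun x ↦ x) r R hR 5 (by norm_num)
  have hu : u.Countable := hdisj.countable_of_nonempty_interior fun x hx ↦
    (nonempty_ball.2 (hr0 x (huS hx))).mono ball_subset_interior_closedBall
  have hSsub : S ⊆ ⋃ x ∈ u, closedBall x (5 * r x) := by
    intro x hx
    obtain ⟨b, hb, hsub⟩ := hcov x hx
    exact Set.mem_iUnion₂.2 ⟨b, hb, hsub (mem_closedBall_self (hr0 x hx).le)⟩
  have := hu.to_subtype
  have h5 : ∀ x ∈ u, t * μ (closedBall x (5 * r x))
      ≤ 5 ^ finrank ℝ E * ∫⁻ y in closedBall x (r x), g y ∂μ := by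
    intro x hx
    have hx0 := hr0 x (huS hx)
    have e : μ (closedBall x (5 * r x)) = 5 ^ finrank ℝ E * μ (ball x (r x)) := by
      rw [Measure.addHaar_closedBall μ x (by positivity), Measure.addHaar_ball_of_pos μ x hx0,
        mul_pow, ENNReal.ofReal_mul (by positivity), ENNReal.ofReal_pow (by norm_num), mul_assoc]
      norm_num
    rw [e, mul_left_comm]
    gcongr
    exact (hr x (huS hx)).le.trans (lintegral_mono_set ball_subset_closedBall)
  calc t * μ S ≤ t * ∑' x : u, μ (closedBall (x : E) (5 * r x)) := by
        gcongr
        refine (measure_mono hSsub).trans ?_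
        rw [Set.biUnion_eq_iUnion]
        exact measure_iUnion_le _
    _ = ∑' x : u, t * μ (closedBall (x : E) (5 * r x)) := ENNReal.tsum_mul_left.symm
    _ ≤ ∑' x : u, 5 ^ finrank ℝ E * ∫⁻ y in closedBall (x : E) (r x), g y ∂μ :=
        ENNReal.tsum_le_tsum fun x ↦ h5 x x.2
    _ = 5 ^ finrank ℝ E * ∫⁻ y in ⋃ x ∈ u, closedBall x (r x), g y ∂μ := by
        rw [ENNReal.tsum_mul_left,
          lintegral_biUnion hu (fun x _ ↦ measurableSet_closedBall) hdisj]
    _ ≤ 5 ^ finrank ℝ E * ∫⁻ y, g y ∂μ := by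
        gcongr 5 ^ finrank ℝ E * ?_
        exact setLIntegral_le_lintegral _ _

/-- The strong type `(p,p)` inequality for the Hardy–Littlewood maximal function. -/
theorem exists_lintegral_ballMaximal_rpow_le [Nontrivial E] {p : ℝ} (hp : 1 < p) :
    ∃ C : ℝ≥0, ∀ g : E → ℝ≥0∞, Measurable g →
      ∫⁻ x, ballMaximal μ 1 g x ^ p ∂μ ≤ C * ∫⁻ x, g x ^ p ∂μ := by
  have hp0 : 0 < p := by linarith
  have hp1 : 0 < p - 1 := by linarith
  refine ⟨p.toNNReal * (2 * 5 ^ finrank ℝ E * ((p - 1)⁻¹.toNNReal * 2 ^ (p - 1))),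
    fun g hg ↦ ?_⟩
  have hmeasM : ∀ t : ℝ, 0 < t → μ {x | ENNReal.ofReal t < ballMaximal μ 1 g x}
      ≤ (2 * 5 ^ finrank ℝ E) * (ENNReal.ofReal t ^ (-1 : ℝ) *
        ∫⁻ y, {y | ENNReal.ofReal t < 2 * g y}.indicator g y ∂μ) := by
    intro t ht
    set s : ℝ≥0∞ := ENNReal.ofReal t / 2 with hs
    have hst : s + s = ENNReal.ofReal t := ENNReal.add_halves _
    have ht0 : ENNReal.ofReal t ≠ 0 := by simpa using ht
    have hset : {y | ENNReal.ofReal t < 2 * g y} = {y | s < g y} := by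
      ext y
      rw [Set.mem_ofPred_eq, Set.mem_ofPred_eq, hs, mul_comm,
        ENNReal.div_lt_iff (Or.inl (by simp)) (Or.inl (by simp))]
    have hsub : {x | ENNReal.ofReal t < ballMaximal μ 1 g x}
        ⊆ {x | s < ballMaximal μ 1 ({y | s < g y}.indicator g) x} := by
      intro x hx
      have h2 := (show ENNReal.ofReal t < _ from hx).trans_le (ballMaximal_le_add μ g s x)
      rw [← hst] at h2
      exact lt_of_add_lt_add_right h2
    have hw := mul_meas_lt_ballMaximal_le μ ({y | s < g y}.indicator g) s
    have hw2 : ENNReal.ofReal t * μ {x | ENNReal.ofReal t < ballMaximal μ 1 g x}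
        ≤ (2 * 5 ^ finrank ℝ E) * ∫⁻ y, {y | s < g y}.indicator g y ∂μ := by
      calc _ = 2 * (s * μ {x | ENNReal.ofReal t < ballMaximal μ 1 g x}) := by
            rw [← hst, two_mul, add_mul]
        _ ≤ 2 * (s * μ {x | s < ballMaximal μ 1 ({y | s < g y}.indicator g) x}) := by
            gcongr 2 * (s * ?_)
            exact measure_mono hsub
        _ ≤ _ := by
            rw [mul_assoc]
            gcongr 2 * ?_
    rw [hset, mul_left_comm, ENNReal.rpow_neg_one, ← ENNReal.div_eq_inv_mul,
      ENNReal.le_div_iff_mul_le (Or.inl ht0) (Or.inl ENNReal.ofReal_ne_top), mul_comm]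
    exact hw2
  have hS : MeasurableSet {z : ℝ × E | ENNReal.ofReal z.1 < 2 * g z.2} :=
    measurableSet_lt (by fun_prop) (by fun_prop)
  have hmeas : Measurable fun z : ℝ × E ↦
      ENNReal.ofReal z.1 ^ (p - 1 - 1) * {y | ENNReal.ofReal z.1 < 2 * g y}.indicator g z.2 :=
    Measurable.mul (by fun_prop)
      (Measurable.indicator (f := fun z : ℝ × E ↦ g z.2) (by fun_prop) hS)
  have hswap : ∫⁻ t in Set.Ioi (0 : ℝ), ENNReal.ofReal t ^ (p - 1 - 1) *
        ∫⁻ y, {y | ENNReal.ofReal t < 2 * g y}.indicator g y ∂μ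
      = (p - 1)⁻¹.toNNReal * 2 ^ (p - 1) * ∫⁻ y, g y ^ p ∂μ := by
    calc _ = ∫⁻ t in Set.Ioi (0 : ℝ), ∫⁻ y, ENNReal.ofReal t ^ (p - 1 - 1) *
          {y | ENNReal.ofReal t < 2 * g y}.indicator g y ∂μ := by
          refine lintegral_congr fun t ↦ ?_
          rw [lintegral_const_mul _ (hg.indicator (measurableSet_lt (by fun_prop) (by fun_prop)))]
      _ = ∫⁻ y, (∫⁻ t in Set.Ioi (0 : ℝ), ENNReal.ofReal t ^ (p - 1 - 1) *
          {y | ENNReal.ofReal t < 2 * g y}.indicator g y) ∂μ :=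
          lintegral_lintegral_swap hmeas.aemeasurable
      _ = ∫⁻ y, (p - 1)⁻¹.toNNReal * 2 ^ (p - 1) * g y ^ p ∂μ := by
          refine lintegral_congr fun y ↦ ?_
          calc _ = ∫⁻ t in Set.Ioi (0 : ℝ), {t : ℝ | ENNReal.ofReal t < 2 * g y}.indicator
                (fun t ↦ ENNReal.ofReal t ^ (p - 1 - 1)) t * g y := by
                refine lintegral_congr fun t ↦ ?_
                by_cases ht : ENNReal.ofReal t < 2 * g y <;> simp [Set.indicator, ht]
            _ = ENNReal.ofReal (p - 1)⁻¹ * (2 * g y) ^ (p - 1) * g y := by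
                rw [lintegral_mul_const _ (Measurable.indicator (by fun_prop)
                  (measurableSet_lt (by fun_prop) (by fun_prop))),
                  lintegral_indicator_lt_rpow hp1]
            _ = _ := by
                rw [ENNReal.mul_rpow_of_nonneg _ _ hp1.le, mul_assoc, mul_assoc, mul_assoc]
                congr 2
                nth_rewrite 2 [← ENNReal.rpow_one (g y)]
                rw [← ENNReal.rpow_add_of_nonneg _ _ hp1.le zero_le_one, sub_add_cancel]
      _ = _ := lintegral_const_mul _ (by fun_prop)
  rw [lintegral_rpow_eq_lintegral_meas_lt μ (measurable_ballMaximal μ 1 g) hp0]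
  calc _ ≤ ENNReal.ofReal p * ∫⁻ t in Set.Ioi (0 : ℝ), (2 * 5 ^ finrank ℝ E) *
        (ENNReal.ofReal t ^ (p - 1 - 1) *
          ∫⁻ y, {y | ENNReal.ofReal t < 2 * g y}.indicator g y ∂μ) := by
        gcongr ENNReal.ofReal p * ?_
        refine setLIntegral_mono' measurableSet_Ioi fun t ht ↦ ?_
        refine (mul_le_mul_right (hmeasM t ht) _).trans_eq ?_
        rw [mul_left_comm, ← mul_assoc (_ ^ (p - 1)), ← ENNReal.rpow_add _ _
          (by simpa using ht) ENNReal.ofReal_ne_top, sub_eq_add_neg (p - 1) 1]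
    _ = _ := by
        rw [lintegral_const_mul' _ _ (by finiteness), hswap]
        push_cast
        rw [ENNReal.coe_rpow_of_nonneg _ hp1.le]
        simp only [mul_assoc]
        rfl

end MaximalFunction

/-! ### Riesz potentials of nonnegative functions -/

section RieszLIntegral

open Metric Module

variable {E : Type*} [NormedAddCommGroup E] [NormedSpace ℝ E] [MeasurableSpace E]

/-- The Riesz potential of order `α` of a function `g ≥ 0`, with values in `[0,∞]`. The kernel is
`∞` on the diagonal. -/
noncomputable def rieszLIntegral (μ : Measure E) (α : ℝ) (g : E → ℝ≥0∞) (x : E) : ℝ≥0∞ :=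
  ∫⁻ y, g y * ‖x - y‖ₑ ^ (α - finrank ℝ E) ∂μ

lemma rieszLIntegral_congr_ae {μ : Measure E} (α : ℝ) {g h : E → ℝ≥0∞} (hgh : g =ᵐ[μ] h) :
    rieszLIntegral μ α g = rieszLIntegral μ α h := by
  ext x
  exact lintegral_congr_ae (hgh.mono fun y hy ↦ by simp only [hy])

variable [BorelSpace E]

lemma rieszLIntegral_add_left (μ : Measure E) (α : ℝ) {g : E → ℝ≥0∞} (hg : Measurable g)
    (h : E → ℝ≥0∞) (x : E) :
    rieszLIntegral μ α (g + h) x = rieszLIntegral μ α g x + rieszLIntegral μ α h x := by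
  simp only [rieszLIntegral, Pi.add_apply, add_mul]
  exact lintegral_add_left (by fun_prop) _

variable [FiniteDimensional ℝ E] (μ : Measure E) [μ.IsAddHaarMeasure]

lemma measurable_rieszLIntegral (α : ℝ) {g : E → ℝ≥0∞} (hg : Measurable g) :
    Measurable (rieszLIntegral μ α g) := by
  have : Measurable fun z : E × E ↦ g z.2 * ‖z.1 - z.2‖ₑ ^ (α - finrank ℝ E) := by
    fun_prop
  exact this.lintegral_prod_right'

/-- Writing the kernel as an integral over the radii of balls turns the Riesz potential into a
weighted integral of the mass of `g` on balls centred at `x`. -/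
lemma rieszLIntegral_eq_lintegral_ball {α : ℝ} (hα : α < finrank ℝ E) {g : E → ℝ≥0∞}
    (hg : Measurable g) (x : E) :
    rieszLIntegral μ α g x = ENNReal.ofReal (finrank ℝ E - α) *
      ∫⁻ s in Set.Ioi (0 : ℝ), ENNReal.ofReal s ^ (α - finrank ℝ E - 1) *
        ∫⁻ y in ball x s, g y ∂μ := by
  set d : ℝ := (finrank ℝ E : ℝ) with hd
  have hms : ∀ y, MeasurableSet {s : ℝ | dist y x < s} := fun y ↦ measurableSet_Ioi
  have hker : ∀ y, ‖x - y‖ₑ ^ (α - d) = ENNReal.ofReal (d - α) *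
      ∫⁻ s in Set.Ioi (0 : ℝ), {s : ℝ | dist y x < s}.indicator
        (fun s ↦ ENNReal.ofReal s ^ (α - d - 1)) s := by
    intro y
    have hset : {s : ℝ | dist y x < s} ∩ Set.Ioi 0 = Set.Ioi (dist y x) :=
      Set.inter_eq_left.2 fun s hs ↦ lt_of_le_of_lt dist_nonneg hs
    rw [lintegral_indicator (hms y), Measure.restrict_restrict (hms y), hset,
      lintegral_Ioi_ofReal_rpow (by linarith) dist_nonneg, ← mul_assoc, ← ENNReal.ofReal_mul
      (by linarith), sub_add_cancel, neg_sub, mul_inv_cancel₀ (by linarith), ENNReal.ofReal_one,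
      one_mul, dist_comm, dist_eq_norm, ofReal_norm]
  have hS : MeasurableSet {z : E × ℝ | dist z.1 x < z.2} :=
    measurableSet_lt (by fun_prop) (by fun_prop)
  have hmeas : Measurable fun z : E × ℝ ↦ g z.1 *
      {s : ℝ | dist z.1 x < s}.indicator (fun s ↦ ENNReal.ofReal s ^ (α - d - 1)) z.2 :=
    Measurable.mul (by fun_prop) (Measurable.indicator
      (f := fun z : E × ℝ ↦ ENNReal.ofReal z.2 ^ (α - d - 1)) (by fun_prop) hS)
  calc rieszLIntegral μ α g x
      = ∫⁻ y, ENNReal.ofReal (d - α) * (∫⁻ s in Set.Ioi (0 : ℝ), g y *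
          {s : ℝ | dist y x < s}.indicator (fun s ↦ ENNReal.ofReal s ^ (α - d - 1)) s) ∂μ := by
        refine lintegral_congr fun y ↦ ?_
        rw [← hd, hker y, lintegral_const_mul _ (Measurable.indicator (by fun_prop) (hms y)),
          mul_left_comm]
    _ = ENNReal.ofReal (d - α) * ∫⁻ s in Set.Ioi (0 : ℝ), ∫⁻ y, g y *
          {s : ℝ | dist y x < s}.indicator (fun s ↦ ENNReal.ofReal s ^ (α - d - 1)) s ∂μ := by
        rw [lintegral_const_mul' _ _ ENNReal.ofReal_ne_top,
          lintegral_lintegral_swap hmeas.aemeasurable]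
    _ = _ := by
        congr 1
        refine lintegral_congr fun s ↦ ?_
        rw [← lintegral_const_mul _ hg, ← lintegral_indicator measurableSet_ball]
        refine lintegral_congr fun y ↦ ?_
        by_cases hy : dist y x < s
        · rw [Set.indicator_of_mem (by exact hy), Set.indicator_of_mem (by exact hy), mul_comm]
        · rw [Set.indicator_of_notMem (by exact hy), Set.indicator_of_notMem (by exact hy),
            mul_zero]

/-- Hölder's inequality on a ball. -/
lemma lintegral_ball_le_rpow_mul {p : ℝ} (hp : 1 < p) {g : E → ℝ≥0∞} (hg : Measurable g) (x : E)
    {s : ℝ} (hs : 0 < s) :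
    ∫⁻ y in ball x s, g y ∂μ ≤ μ (ball 0 1) ^ (1 - 1 / p) *
      ((∫⁻ y in ball x s, g y ^ p ∂μ) ^ (1 / p) *
        ENNReal.ofReal s ^ (finrank ℝ E * (1 - 1 / p))) := by
  have hpq : p.HolderConjugate p.conjExponent := Real.HolderConjugate.conjExponent hp
  have h := ENNReal.lintegral_mul_le_Lp_mul_Lq (μ.restrict (ball x s)) hpq hg.aemeasurable
    (aemeasurable_const (b := (1 : ℝ≥0∞)))
  have hexp : 1 / p.conjExponent = 1 - 1 / p := by
    rw [one_div, one_div, hpq.inv_add_inv_eq_one.symm]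
    ring
  have h1 : 0 ≤ 1 - 1 / p := by
    rw [sub_nonneg, div_le_one (by linarith)]
    exact hp.le
  simp only [Pi.mul_apply, mul_one, ENNReal.one_rpow, lintegral_const, one_mul,
    Measure.restrict_apply_univ, hexp] at h
  rw [addHaar_ball_eq_ofReal_rpow μ x hs, ENNReal.mul_rpow_of_nonneg _ _ h1,
    ← ENNReal.rpow_mul] at h
  exact h.trans_eq (by ring)

/-- Optimising `R ^ a * m + R ^ (-b) * N` over `R`. -/
lemma le_rpow_mul_rpow_of_forall_le {J m N : ℝ≥0∞} {C : ℝ≥0} {a b : ℝ} (ha : 0 < a) (hb : 0 < b)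
    (hN0 : N ≠ 0) (hN : N ≠ ∞)
    (h : ∀ R : ℝ, 0 < R → J ≤ C * (ENNReal.ofReal R ^ a * m + ENNReal.ofReal R ^ (-b) * N)) :
    J ≤ 2 * (C + 1) * (m ^ (b / (a + b)) * N ^ (a / (a + b))) := by
  have hab : 0 < a + b := by linarith
  have key : ∀ m' : ℝ≥0∞, m ≤ m' → m' ≠ 0 → m' ≠ ∞ →
      J ≤ 2 * (C + 1) * (m' ^ (b / (a + b)) * N ^ (a / (a + b))) := by
    intro m' hmm hm0 hm
    -- the radius at which the two terms agree
    set ρ : ℝ≥0∞ := (N / m') ^ (1 / (a + b)) with hρ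
    have hq0 : N / m' ≠ 0 := ENNReal.div_ne_zero.2 ⟨hN0, hm⟩
    have hq1 : N / m' ≠ ∞ := ENNReal.div_ne_top hN hm0
    have hρ0 : ρ ≠ 0 := by simp [hρ, ENNReal.rpow_eq_zero_iff, hq0, hq1]
    have hρ1 : ρ ≠ ∞ := by simp [hρ, ENNReal.rpow_eq_top_iff, hq0, hq1]
    have h1 := h ρ.toReal (ENNReal.toReal_pos hρ0 hρ1)
    rw [ENNReal.ofReal_toReal hρ1] at h1
    have e : ∀ c, ρ ^ c = N ^ (c / (a + b)) * m' ^ (-(c / (a + b))) := by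
      intro c
      rw [hρ, ← ENNReal.rpow_mul, ENNReal.div_eq_inv_mul, mul_comm,
        ENNReal.mul_rpow_of_ne_top hN (ENNReal.inv_ne_top.2 hm0), ENNReal.inv_rpow,
        ← ENNReal.rpow_neg, one_div_mul_eq_div]
    have e1 : ρ ^ a * m' = m' ^ (b / (a + b)) * N ^ (a / (a + b)) := by
      rw [e, mul_assoc]
      nth_rewrite 2 [← ENNReal.rpow_one m']
      rw [← ENNReal.rpow_add _ _ hm0 hm, mul_comm]
      congr 2
      field_simp
      ring
    have e2 : ρ ^ (-b) * N = m' ^ (b / (a + b)) * N ^ (a / (a + b)) := by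
      rw [e, mul_right_comm]
      nth_rewrite 2 [← ENNReal.rpow_one N]
      rw [← ENNReal.rpow_add _ _ hN0 hN, mul_comm]
      congr 2
      · field_simp
      · field_simp
        ring
    calc J ≤ C * (ρ ^ a * m + ρ ^ (-b) * N) := h1
      _ ≤ C * (ρ ^ a * m' + ρ ^ (-b) * N) := by gcongr
      _ = 2 * C * (m' ^ (b / (a + b)) * N ^ (a / (a + b))) := by
          rw [e1, e2]
          ring
      _ ≤ _ := by
          gcongr
          exact le_self_add
  have hbab : 0 < b / (a + b) := by positivity
  have haab : 0 < a / (a + b) := by positivity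
  by_cases hm : m = ∞
  · rw [hm, ENNReal.top_rpow_of_pos hbab, ENNReal.top_mul (by simp [hN0, hN]),
      ENNReal.mul_top (by simp)]
    exact le_top
  by_cases hm0 : m = 0
  -- no radius balances the two terms, so `m` is replaced by `m' > 0` with `m' → 0`
  · have ht : Tendsto (fun m' : ℝ≥0∞ ↦ 2 * (C + 1) * (m' ^ (b / (a + b)) * N ^ (a / (a + b))))
        (𝓝[>] 0) (𝓝 (2 * (C + 1) * (0 ^ (b / (a + b)) * N ^ (a / (a + b))))) := by
      refine ENNReal.Tendsto.const_mul ?_ (Or.inr (by finiteness))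
      refine ENNReal.Tendsto.mul_const ?_ (Or.inr (by simp [hN, haab.le]))
      exact ((ENNReal.continuous_rpow_const).tendsto 0).mono_left nhdsWithin_le_nhds
    rw [hm0]
    refine ge_of_tendsto ht ?_
    filter_upwards [self_mem_nhdsWithin, mem_nhdsWithin_of_mem_nhds
      (gt_mem_nhds (ENNReal.zero_lt_top))] with m' h1 h2
    exact key m' (by simp [hm0]) (ne_of_gt h1) h2.ne
  · exact key m le_rfl hm0 hm

/-- Integration over the radii above `r` of a power bound for the mass on balls. -/
lemma lintegral_Ioi_mul_le {G : ℝ → ℝ≥0∞} {A : ℝ≥0∞} {γ β r : ℝ} (hr : 0 < r)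
    (hγβ : γ + β < 0) (hG : ∀ s, r < s → G s ≤ A * ENNReal.ofReal s ^ β) :
    ∫⁻ s in Set.Ioi r, ENNReal.ofReal s ^ (γ - 1) * G s
      ≤ ENNReal.ofReal (-(γ + β))⁻¹ * (A * ENNReal.ofReal r ^ (γ + β)) := by
  calc _ ≤ ∫⁻ s in Set.Ioi r, A * ENNReal.ofReal s ^ (γ + β - 1) := by
        refine setLIntegral_mono' measurableSet_Ioi fun s hs ↦ ?_
        have hs0 : ENNReal.ofReal s ≠ 0 := by simpa using hr.trans hs
        calc _ ≤ ENNReal.ofReal s ^ (γ - 1) * (A * ENNReal.ofReal s ^ β) := by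
              gcongr
              exact hG s hs
          _ = _ := by
              rw [mul_left_comm, ← ENNReal.rpow_add _ _ hs0 ENNReal.ofReal_ne_top]
              congr 2
              ring
    _ = _ := by
        rw [lintegral_const_mul _ (by fun_prop), lintegral_Ioi_ofReal_rpow (by linarith) hr.le,
          sub_add_cancel]
        ring

/-- Integration over the radii below `r` of a power bound for the mass on balls. -/
lemma lintegral_Ioo_mul_le {G : ℝ → ℝ≥0∞} {A : ℝ≥0∞} {γ β r : ℝ} (hr : 0 < r)
    (hγβ : 0 < γ + β) (hG : ∀ s, 0 < s → G s ≤ A * ENNReal.ofReal s ^ β) :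
    ∫⁻ s in Set.Ioo 0 r, ENNReal.ofReal s ^ (γ - 1) * G s
      ≤ ENNReal.ofReal (γ + β)⁻¹ * (A * ENNReal.ofReal r ^ (γ + β)) := by
  calc _ ≤ ∫⁻ s in Set.Ioo 0 r, A * ENNReal.ofReal s ^ (γ + β - 1) := by
        refine setLIntegral_mono' measurableSet_Ioo fun s hs ↦ ?_
        have hs0 : ENNReal.ofReal s ≠ 0 := by simpa using hs.1
        calc _ ≤ ENNReal.ofReal s ^ (γ - 1) * (A * ENNReal.ofReal s ^ β) := by
              gcongr
              exact hG s hs.1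
          _ = _ := by
              rw [mul_left_comm, ← ENNReal.rpow_add _ _ hs0 ENNReal.ofReal_ne_top]
              congr 2
              ring
    _ = _ := by
        rw [lintegral_const_mul _ (by fun_prop), lintegral_Ioo_ofReal_rpow (by linarith) hr.le,
          sub_add_cancel]
        ring

/-- Hedberg's inequality: the Riesz potential is controlled pointwise by the maximal function and
the `L^p` norm. -/
theorem exists_rieszLIntegral_le_ballMaximal {α p : ℝ} (hα : 0 < α) (hp : 1 < p)
    (hαp : α * p < finrank ℝ E) :
    ∃ C : ℝ≥0, ∀ g : E → ℝ≥0∞, Measurable g → ∫⁻ y, g y ^ p ∂μ ≠ 0 → ∫⁻ y, g y ^ p ∂μ ≠ ∞ →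
      ∀ x, rieszLIntegral μ α g x ≤ C * (ballMaximal μ 1 g x ^ (1 - α * p / finrank ℝ E) *
        (∫⁻ y, g y ^ p ∂μ) ^ (α / finrank ℝ E)) := by
  set d : ℝ := (finrank ℝ E : ℝ) with hd
  have hp0 : 0 < p := by linarith
  have hd0 : 0 < d := lt_trans (by positivity) hαp
  have hαd : α < d := by nlinarith
  have hb : 0 < d / p - α := by rw [sub_pos, lt_div_iff₀ hp0]; exact hαp
  have hc1 : μ (ball 0 1) ≠ ∞ := measure_ball_lt_top.ne
  set c : ℝ≥0 := (μ (ball 0 1)).toNNReal with hc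
  have hcc : μ (ball 0 1) = c := (ENNReal.coe_toNNReal hc1).symm
  have h1p : 0 ≤ 1 - 1 / p := by
    rw [sub_nonneg, div_le_one hp0]
    exact hp.le
  set C : ℝ≥0 := (d - α).toNNReal * (α⁻¹.toNNReal * c + (d / p - α)⁻¹.toNNReal * c ^ (1 - 1 / p))
    with hC
  refine ⟨2 * (C + 1), fun g hg hI0 hI x ↦ ?_⟩
  set I := ∫⁻ y, g y ^ p ∂μ with hIdef
  set m := ballMaximal μ 1 g x
  have hN0 : I ^ (1 / p) ≠ 0 := by simp [ENNReal.rpow_eq_zero_iff, hI0, hI]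
  have hN : I ^ (1 / p) ≠ ∞ := by simp [ENNReal.rpow_eq_top_iff, hI0, hI]
  have hbound : ∀ R : ℝ, 0 < R → rieszLIntegral μ α g x ≤
      C * (ENNReal.ofReal R ^ α * m + ENNReal.ofReal R ^ (-(d / p - α)) * I ^ (1 / p)) := by
    intro R hR
    have hnear : ∫⁻ s in Set.Ioo 0 R, ENNReal.ofReal s ^ (α - d - 1) * ∫⁻ y in ball x s, g y ∂μ
        ≤ ENNReal.ofReal α⁻¹ * (m * c * ENNReal.ofReal R ^ α) := by
      have := lintegral_Ioo_mul_le (G := fun s ↦ ∫⁻ y in ball x s, g y ∂μ) (A := m * c)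
        (γ := α - d) (β := d) hR (by linarith) (fun s hs ↦ by
          refine (lintegral_ball_le_ballMaximal μ g x hs).trans_eq ?_
          rw [addHaar_ball_eq_ofReal_rpow μ x hs, hcc]
          ring)
      simpa only [sub_add_cancel] using this
    have hfar : ∫⁻ s in Set.Ioi R, ENNReal.ofReal s ^ (α - d - 1) * ∫⁻ y in ball x s, g y ∂μ
        ≤ ENNReal.ofReal (d / p - α)⁻¹ *
          ((c : ℝ≥0∞) ^ (1 - 1 / p) * I ^ (1 / p) * ENNReal.ofReal R ^ (-(d / p - α))) := by
      have hexp : α - d + d * (1 - 1 / p) = -(d / p - α) := by ring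
      have := lintegral_Ioi_mul_le (G := fun s ↦ ∫⁻ y in ball x s, g y ∂μ)
        (A := (c : ℝ≥0∞) ^ (1 - 1 / p) * I ^ (1 / p))
        (γ := α - d) (β := d * (1 - 1 / p)) hR (by linarith) (fun s hs ↦ by
          refine (lintegral_ball_le_rpow_mul μ hp hg x (hR.trans hs)).trans ?_
          rw [hcc, mul_assoc]
          gcongr
          exact setLIntegral_le_lintegral _ _)
      rwa [hexp, neg_neg] at this
    rw [rieszLIntegral_eq_lintegral_ball μ hαd hg, ← hd, ← Set.Ioc_union_Ioi_eq_Ioi hR.le,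
      lintegral_union measurableSet_Ioi Set.Ioc_disjoint_Ioi_same,
      setLIntegral_congr Ioo_ae_eq_Ioc.symm]
    calc _ ≤ ENNReal.ofReal (d - α) * (ENNReal.ofReal α⁻¹ * (m * c * ENNReal.ofReal R ^ α) +
          ENNReal.ofReal (d / p - α)⁻¹ *
          ((c : ℝ≥0∞) ^ (1 - 1 / p) * I ^ (1 / p) * ENNReal.ofReal R ^ (-(d / p - α)))) := by
          gcongr
      _ = ENNReal.ofReal (d - α) * ((ENNReal.ofReal α⁻¹ * c) * (ENNReal.ofReal R ^ α * m) +
          (ENNReal.ofReal (d / p - α)⁻¹ * (c : ℝ≥0∞) ^ (1 - 1 / p)) *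
          (ENNReal.ofReal R ^ (-(d / p - α)) * I ^ (1 / p))) := by ring
      _ ≤ ENNReal.ofReal (d - α) * ((ENNReal.ofReal α⁻¹ * c +
            ENNReal.ofReal (d / p - α)⁻¹ * (c : ℝ≥0∞) ^ (1 - 1 / p)) * (ENNReal.ofReal R ^ α * m) +
          (ENNReal.ofReal α⁻¹ * c + ENNReal.ofReal (d / p - α)⁻¹ * (c : ℝ≥0∞) ^ (1 - 1 / p)) *
            (ENNReal.ofReal R ^ (-(d / p - α)) * I ^ (1 / p))) := by
          gcongr
          · exact le_self_add
          · exact le_add_self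
      _ = _ := by
          rw [hC]
          push_cast
          rw [ENNReal.coe_rpow_of_nonneg _ h1p]
          simp only [ENNReal.ofReal]
          ring
  have h := le_rpow_mul_rpow_of_forall_le hα hb hN0 hN hbound
  refine h.trans_eq ?_
  have hsum : α + (d / p - α) = d / p := by ring
  have e1 : (d / p - α) / (d / p) = 1 - α * p / d := by field_simp
  have e2 : 1 / p * (α / (d / p)) = α / d := by field_simp
  rw [← ENNReal.rpow_mul, hsum, e1, e2]
  push_cast
  rfl

/-- The Hardy–Littlewood–Sobolev inequality, in integrated form. -/
theorem exists_lintegral_rieszLIntegral_rpow_le {α p q : ℝ} (hα : 0 < α) (hp : 1 < p)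
    (hαp : α * p < finrank ℝ E) (hq : 1 / q = 1 / p - α / finrank ℝ E) :
    ∃ C : ℝ≥0, ∀ g : E → ℝ≥0∞, Measurable g → ∫⁻ y, g y ^ p ∂μ ≠ ∞ →
      ∫⁻ x, rieszLIntegral μ α g x ^ q ∂μ ≤ C * (∫⁻ y, g y ^ p ∂μ) ^ (q / p) := by
  have hp0 : 0 < p := by linarith
  have hd0 : 0 < (finrank ℝ E : ℝ) := lt_trans (by positivity) hαp
  have : Nontrivial E := nontrivial_of_finrank_pos (R := ℝ) (by exact_mod_cast hd0)
  have hq0 : 0 < q := by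
    rw [← one_div_pos, hq, sub_pos, div_lt_div_iff₀ hd0 hp0]
    linarith
  obtain ⟨C₁, hC₁⟩ := exists_rieszLIntegral_le_ballMaximal μ hα hp hαp
  obtain ⟨C₂, hC₂⟩ := exists_lintegral_ballMaximal_rpow_le μ hp
  refine ⟨C₁ ^ q * C₂, fun g hg hI ↦ ?_⟩
  rcases eq_or_ne (∫⁻ y, g y ^ p ∂μ) 0 with hI0 | hI0
  · have hg0 : g =ᵐ[μ] 0 := by
      rw [lintegral_eq_zero_iff (by fun_prop)] at hI0
      filter_upwards [hI0] with y hy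
      simpa [ENNReal.rpow_eq_zero_iff, hp0, hp0.not_gt] using hy
    rw [rieszLIntegral_congr_ae α hg0]
    simp [rieszLIntegral, hq0]
  set I := ∫⁻ y, g y ^ p ∂μ
  have e1 : (1 - α * p / finrank ℝ E) * q = p := by
    field_simp at hq ⊢
    linear_combination -hq
  have e2 : α / finrank ℝ E * q + 1 = q / p := by
    field_simp at hq ⊢
    linear_combination hq
  calc ∫⁻ x, rieszLIntegral μ α g x ^ q ∂μ
      ≤ ∫⁻ x, (C₁ : ℝ≥0∞) ^ q * I ^ (α / finrank ℝ E * q) * ballMaximal μ 1 g x ^ p ∂μ := by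
        refine lintegral_mono fun x ↦ ?_
        refine (ENNReal.rpow_le_rpow (hC₁ g hg hI0 hI x) hq0.le).trans_eq ?_
        rw [ENNReal.mul_rpow_of_nonneg _ _ hq0.le, ENNReal.mul_rpow_of_nonneg _ _ hq0.le,
          ← ENNReal.rpow_mul, ← ENNReal.rpow_mul, e1]
        ring
    _ = (C₁ : ℝ≥0∞) ^ q * I ^ (α / finrank ℝ E * q) * ∫⁻ x, ballMaximal μ 1 g x ^ p ∂μ :=
        lintegral_const_mul _ ((measurable_ballMaximal μ 1 g).pow_const _)
    _ ≤ (C₁ : ℝ≥0∞) ^ q * I ^ (α / finrank ℝ E * q) * (C₂ * I) := by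
        gcongr
        exact hC₂ g hg
    _ = _ := by
        rw [← e2, ENNReal.rpow_add _ _ hI0 hI, ENNReal.rpow_one, ENNReal.coe_mul,
          ENNReal.coe_rpow_of_nonneg _ hq0.le]
        ring

/-- The local estimate behind the Morrey bounds. If the `L^p` mass of `g` on every ball of radius
`s ≥ r` is at most `K * s ^ lam`, then the Riesz potential has `L^q` mass at most
`C * K ^ (q / p) * r ^ mu` on balls of radius `r`. The part of `g` in the ball of radius `2 * r`
is controlled by the Hardy–Littlewood–Sobolev inequality, and only balls of radius at least `r`
enter the potential of the rest. -/
theorem exists_lintegral_ball_rieszLIntegral_rpow_le {α p q lam mu : ℝ} (hα : 0 < α) (hp : 1 < p)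
    (hlam : 0 ≤ lam) (hlam_lt : lam < finrank ℝ E - α * p)
    (hq : 1 / q = 1 / p - α / finrank ℝ E) (hmu : lam / p = mu / q) :
    ∃ C : ℝ≥0, ∀ g : E → ℝ≥0∞, Measurable g → ∀ (K : ℝ≥0∞) (r : ℝ), K ≠ ∞ → 0 < r →
      (∀ y s, r ≤ s → ∫⁻ z in ball y s, g z ^ p ∂μ ≤ K * ENNReal.ofReal s ^ lam) →
      ∀ x, ∫⁻ y in ball x r, rieszLIntegral μ α g y ^ q ∂μ
        ≤ C * (K ^ (q / p) * ENNReal.ofReal r ^ mu) := by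
  have hp0 : 0 < p := by linarith
  have hαp : α * p < finrank ℝ E := by linarith
  obtain ⟨C₁, hC₁⟩ := exists_lintegral_rieszLIntegral_rpow_le μ hα hp hαp hq
  set d : ℝ := (finrank ℝ E : ℝ) with hd
  have hd0 : 0 < d := lt_trans (by positivity) hαp
  have hαd : α < d := by nlinarith
  have hq0 : 0 < q := by
    rw [← one_div_pos, hq, sub_pos, div_lt_div_iff₀ hd0 hp0]
    linarith
  have hpq : p ≤ q := by
    rw [← one_div_le_one_div hq0 hp0, hq]
    have : 0 < α / d := by positivity
    linarith
  have hc1 : μ (ball 0 1) ≠ ∞ := measure_ball_lt_top.ne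
  set c : ℝ≥0 := (μ (ball 0 1)).toNNReal with hc
  have hcc : μ (ball 0 1) = c := (ENNReal.coe_toNNReal hc1).symm
  have h1p : 0 ≤ 1 - 1 / p := by
    rw [sub_nonneg, div_le_one hp0]
    exact hp.le
  have hδ : 0 < d / p - α - lam / p := by
    have : d / p - α - lam / p = (d - α * p - lam) / p := by field_simp
    rw [this]
    apply div_pos _ hp0
    linarith
  set δ := d / p - α - lam / p with hδdef
  set C₂ : ℝ≥0 := (d - α).toNNReal * δ⁻¹.toNNReal * c ^ (1 - 1 / p) with hC₂
  refine ⟨2 ^ (q - 1) * (C₁ * 2 ^ mu + C₂ ^ q * c), fun g hg K r hK hr hKr x ↦ ?_⟩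
  have hr0 : ENNReal.ofReal r ≠ 0 := by simpa using hr
  have hmu' : lam * (q / p) = mu := by
    field_simp at hmu ⊢
    linear_combination hmu
  have hmu0 : 0 ≤ mu := by rw [← hmu']; positivity
  set g₁ := (ball x (2 * r)).indicator g with hg₁
  set g₂ := (ball x (2 * r))ᶜ.indicator g with hg₂
  have hg₁m : Measurable g₁ := hg.indicator measurableSet_ball
  have hg₂m : Measurable g₂ := hg.indicator measurableSet_ball.compl
  have hnear : ∫⁻ y, rieszLIntegral μ α g₁ y ^ q ∂μ
      ≤ C₁ * 2 ^ mu * (K ^ (q / p) * ENNReal.ofReal r ^ mu) := by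
    have h1 : ∫⁻ y, g₁ y ^ p ∂μ ≤ K * ENNReal.ofReal (2 * r) ^ lam := by
      refine le_trans (le_of_eq ?_) (hKr x (2 * r) (by linarith))
      rw [← lintegral_indicator measurableSet_ball]
      refine lintegral_congr fun y ↦ ?_
      by_cases hy : y ∈ ball x (2 * r)
      · simp [hg₁, hy]
      · simp [hg₁, hy, hp0]
    have h2 : K * ENNReal.ofReal (2 * r) ^ lam ≠ ∞ := by finiteness
    calc _ ≤ C₁ * (∫⁻ y, g₁ y ^ p ∂μ) ^ (q / p) := hC₁ g₁ hg₁m (ne_top_of_le_ne_top h2 h1)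
      _ ≤ C₁ * (K * ENNReal.ofReal (2 * r) ^ lam) ^ (q / p) := by gcongr
      _ = _ := by
          rw [ENNReal.mul_rpow_of_nonneg _ _ (by positivity), ← ENNReal.rpow_mul, hmu',
            ENNReal.ofReal_mul zero_le_two, ENNReal.mul_rpow_of_nonneg _ _ hmu0]
          simp only [ENNReal.ofReal_ofNat]
          ring
  have hfar : ∀ y ∈ ball x r, rieszLIntegral μ α g₂ y
      ≤ C₂ * (K ^ (1 / p) * ENNReal.ofReal r ^ (-δ)) := by
    intro y hy
    -- a ball about `y` of radius at most `r` lies inside `ball x (2 * r)`, where `g₂` vanishes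
    have hzero : ∀ s, s ≤ r → ∫⁻ z in ball y s, g₂ z ∂μ = 0 := by
      intro s hs
      rw [setLIntegral_congr_fun (g := fun _ ↦ 0) measurableSet_ball, lintegral_zero]
      intro z hz
      refine Set.indicator_of_notMem ?_ _
      rw [Set.notMem_compl_iff]
      exact ball_subset_ball' (by rw [mem_ball] at hy; linarith) hz
    rw [rieszLIntegral_eq_lintegral_ball μ hαd hg₂m, ← hd, ← Set.Ioc_union_Ioi_eq_Ioi hr.le,
      lintegral_union measurableSet_Ioi Set.Ioc_disjoint_Ioi_same,
      setLIntegral_congr_fun (g := fun _ ↦ 0) measurableSet_Ioc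
        (fun s hs ↦ by simp only [hzero s hs.2, mul_zero]), lintegral_zero, zero_add]
    have hexp : α - d + (lam / p + d * (1 - 1 / p)) = -δ := by rw [hδdef]; ring
    have := lintegral_Ioi_mul_le (G := fun s ↦ ∫⁻ z in ball y s, g₂ z ∂μ)
      (A := (c : ℝ≥0∞) ^ (1 - 1 / p) * K ^ (1 / p))
      (γ := α - d) (β := lam / p + d * (1 - 1 / p)) hr (by linarith) (fun s hs ↦ by
        have hs0 : 0 < s := hr.trans hs
        refine (lintegral_ball_le_rpow_mul μ hp hg₂m y hs0).trans ?_
        rw [hcc, mul_assoc]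
        gcongr _ * ?_
        rw [ENNReal.rpow_add _ _ (by simpa using hs0) ENNReal.ofReal_ne_top, ← mul_assoc]
        gcongr ?_ * _
        calc _ ≤ (K * ENNReal.ofReal s ^ lam) ^ (1 / p) := by
              gcongr
              refine le_trans (lintegral_mono fun z ↦ ?_) (hKr y s hs.le)
              gcongr
              exact Set.indicator_le_self _ _ _
          _ = _ := by
              rw [ENNReal.mul_rpow_of_nonneg _ _ (by positivity), ← ENNReal.rpow_mul,
                mul_one_div])
    rw [hexp, neg_neg] at this
    calc _ ≤ ENNReal.ofReal (d - α) * (ENNReal.ofReal δ⁻¹ *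
          ((c : ℝ≥0∞) ^ (1 - 1 / p) * K ^ (1 / p) * ENNReal.ofReal r ^ (-δ))) := by gcongr
      _ = _ := by
          rw [hC₂]
          push_cast
          rw [← ENNReal.coe_rpow_of_nonneg _ h1p]
          simp only [mul_assoc]
          rfl
  have hsum : g = g₁ + g₂ := (Set.indicator_self_add_compl _ _).symm
  have hδq : -δ * q + d = mu := by
    rw [hδdef]
    field_simp at hq hmu ⊢
    linear_combination hmu + hq
  calc ∫⁻ y in ball x r, rieszLIntegral μ α g y ^ q ∂μ
      ≤ ∫⁻ y in ball x r, 2 ^ (q - 1) * (rieszLIntegral μ α g₁ y ^ q +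
          (C₂ * (K ^ (1 / p) * ENNReal.ofReal r ^ (-δ))) ^ q) ∂μ := by
        refine setLIntegral_mono' measurableSet_ball fun y hy ↦ ?_
        rw [hsum, rieszLIntegral_add_left μ α hg₁m]
        refine (ENNReal.rpow_add_le_mul_rpow_add_rpow _ _ (hp.le.trans hpq)).trans ?_
        gcongr
        exact hfar y hy
    _ = 2 ^ (q - 1) * (∫⁻ y in ball x r, rieszLIntegral μ α g₁ y ^ q ∂μ +
          (C₂ * (K ^ (1 / p) * ENNReal.ofReal r ^ (-δ))) ^ q * μ (ball x r)) := by
        rw [lintegral_const_mul' _ _ (by finiteness), lintegral_add_right _ measurable_const,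
          setLIntegral_const]
    _ ≤ 2 ^ (q - 1) * (C₁ * 2 ^ mu * (K ^ (q / p) * ENNReal.ofReal r ^ mu) +
          (C₂ : ℝ≥0∞) ^ q * c * (K ^ (q / p) * ENNReal.ofReal r ^ mu)) := by
        refine mul_le_mul_right (add_le_add ?_ ?_) _
        · exact (setLIntegral_le_lintegral _ _).trans hnear
        · rw [addHaar_ball_eq_ofReal_rpow μ x hr, hcc, ENNReal.mul_rpow_of_nonneg _ _ hq0.le,
            ENNReal.mul_rpow_of_nonneg _ _ hq0.le, ← ENNReal.rpow_mul, ← ENNReal.rpow_mul,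
            one_div_mul_eq_div, ← hδq, ENNReal.rpow_add _ _ hr0 ENNReal.ofReal_ne_top]
          exact le_of_eq (by ring)
    _ = _ := by
        push_cast
        rw [ENNReal.coe_rpow_of_nonneg _ hq0.le, ENNReal.coe_rpow_of_nonneg _ hmu0,
          ENNReal.coe_rpow_of_nonneg _ (by linarith : 0 ≤ q - 1)]
        push_cast
        ring

end RieszLIntegral

/-! ### Morrey spaces -/

section Morrey

open Metric Module

variable {n : ℕ} {F : Type*} [ENorm F]

lemma morreyModular_le_iff {p lam r : ℝ} {f : EuclideanSpace ℝ (Fin n) → F}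
    {x : EuclideanSpace ℝ (Fin n)} {K : ℝ≥0∞} (hr : 0 < r) :
    morreyModular p lam f x r ≤ K ↔
      ∫⁻ y in ball x r, ‖f y‖ₑ ^ p ≤ K * ENNReal.ofReal r ^ lam := by
  rw [morreyModular, ENNReal.div_le_iff_le_mul, ENNReal.ofReal_rpow_of_pos hr]
  · exact Or.inl (by simpa using Real.rpow_pos_of_pos hr lam)
  · exact Or.inl ENNReal.ofReal_ne_top

lemma morreyModular_le_morreyNorm_rpow {p lam r : ℝ} (hp : 0 < p)
    (f : EuclideanSpace ℝ (Fin n) → F) (x : EuclideanSpace ℝ (Fin n)) (hr : 0 < r) :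
    morreyModular p lam f x r ≤ morreyNorm p lam f ^ p := by
  have h : morreyModular p lam f x r ^ (1 / p) ≤ morreyNorm p lam f :=
    (le_iSup₂_of_le r hr le_rfl).trans (le_iSup (fun x ↦ ⨆ (r : ℝ) (_ : 0 < r),
      morreyModular p lam f x r ^ (1 / p)) x)
  rwa [one_div, ENNReal.rpow_inv_le_iff hp] at h

lemma morreyNorm_le_of_forall_morreyModular_le {p lam : ℝ} (hp : 0 < p)
    {f : EuclideanSpace ℝ (Fin n) → F} {K : ℝ≥0∞}
    (h : ∀ x r, 0 < r → morreyModular p lam f x r ≤ K) : morreyNorm p lam f ≤ K ^ (1 / p) :=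
  iSup_le fun x ↦ iSup₂_le fun r hr ↦ ENNReal.rpow_le_rpow (h x r hr) (by positivity)

lemma morreyModular_le_mul_of_ae_le {G : Type*} [ENorm G] {q mu : ℝ} (hq : 0 ≤ q) {A : ℝ≥0}
    {f : EuclideanSpace ℝ (Fin n) → F} {g : EuclideanSpace ℝ (Fin n) → G}
    (h : ∀ᵐ x, ‖f x‖ₑ ≤ A * ‖g x‖ₑ) (x : EuclideanSpace ℝ (Fin n)) (r : ℝ) :
    morreyModular q mu f x r ≤ (A : ℝ≥0∞) ^ q * morreyModular q mu g x r := by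
  rw [morreyModular, morreyModular, ← mul_div_assoc,
    ← lintegral_const_mul' _ _ (by finiteness)]
  refine ENNReal.div_le_div_right (lintegral_mono_ae ?_) _
  filter_upwards [ae_restrict_of_ae h] with y hy
  rw [← ENNReal.mul_rpow_of_nonneg _ _ hq]
  gcongr

section Riesz

variable {α p q lam mu : ℝ}

/-- The Riesz potential of `‖f‖` has modulars at the radius `r` controlled by the modulars of `f`
at radii at least `r`. This one estimate gives both the norm bound and the vanishing at infinity. -/
theorem exists_morreyModular_rieszLIntegral_le (hα : 0 < α) (hp : 1 < p)
    (hlam : 0 ≤ lam) (hlam_lt : lam < n - α * p)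
    (hq : 1 / q = 1 / p - α / n) (hmu : lam / p = mu / q) :
    ∃ C : ℝ≥0, ∀ f : EuclideanSpace ℝ (Fin n) → ℂ, AEStronglyMeasurable f volume →
      ∀ (K : ℝ≥0∞) (r : ℝ), K ≠ ∞ → 0 < r →
      (∀ y s, r ≤ s → morreyModular p lam f y s ≤ K) →
      ∀ x, morreyModular q mu (rieszLIntegral volume α fun y ↦ ‖f y‖ₑ) x r ≤ C * K ^ (q / p) := by
  have hn : (finrank ℝ (EuclideanSpace ℝ (Fin n)) : ℝ) = n := by simp
  rw [← hn] at hlam_lt hq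
  obtain ⟨C, hC⟩ := exists_lintegral_ball_rieszLIntegral_rpow_le
    (volume : Measure (EuclideanSpace ℝ (Fin n))) hα hp hlam hlam_lt hq hmu
  refine ⟨C, fun f hf K r hK hr hKr x ↦ ?_⟩
  have hae : (fun y ↦ ‖f y‖ₑ) =ᵐ[volume] fun y ↦ ‖hf.mk f y‖ₑ :=
    hf.ae_eq_mk.mono fun y hy ↦ by simp only [hy]
  rw [morreyModular_le_iff hr, rieszLIntegral_congr_ae α hae, mul_assoc]
  refine hC _ hf.stronglyMeasurable_mk.enorm K r hK hr (fun y s hs ↦ ?_) x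
  refine le_trans (le_of_eq (lintegral_congr_ae (ae_restrict_of_ae ?_)))
    ((morreyModular_le_iff (hr.trans_le hs)).1 (hKr y s hs))
  filter_upwards [hae] with z hz
  rw [hz]

lemma ae_rieszLIntegral_lt_top (hα : 0 < α) (hp : 1 < p)
    (hlam : 0 ≤ lam) (hlam_lt : lam < n - α * p)
    (hq : 1 / q = 1 / p - α / n) (hq0 : 0 < q) (hmu : lam / p = mu / q)
    {f : EuclideanSpace ℝ (Fin n) → ℂ} (hf : MemMorrey p lam f) :
    ∀ᵐ x, rieszLIntegral volume α (fun y ↦ ‖f y‖ₑ) x < ∞ := by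
  have hp0 : 0 < p := by linarith
  obtain ⟨C, hC⟩ := exists_morreyModular_rieszLIntegral_le hα hp hlam hlam_lt hq hmu
  have hK : morreyNorm p lam f ^ p ≠ ∞ := ENNReal.rpow_ne_top_of_nonneg hp0.le hf.2.ne
  have hmeas : Measurable (rieszLIntegral volume α fun y ↦ ‖f y‖ₑ) := by
    have hae : (fun y ↦ ‖f y‖ₑ) =ᵐ[volume] fun y ↦ ‖hf.1.mk f y‖ₑ :=
      hf.1.ae_eq_mk.mono fun y hy ↦ by simp only [hy]
    rw [rieszLIntegral_congr_ae α hae]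
    exact measurable_rieszLIntegral _ _ hf.1.stronglyMeasurable_mk.enorm
  -- the power `q` of the potential is integrable on every ball
  have hball : ∀ k : ℕ, ∀ᵐ x ∂volume.restrict (ball (0 : EuclideanSpace ℝ (Fin n)) k),
      rieszLIntegral volume α (fun y ↦ ‖f y‖ₑ) x < ∞ := by
    intro k
    rcases Nat.eq_zero_or_pos k with rfl | hk
    · simp
    have hk' : (0 : ℝ) < k := by exact_mod_cast hk
    have h := (morreyModular_le_iff hk').1 (hC f hf.1 _ k hK hk' (fun y s hs ↦
      morreyModular_le_morreyNorm_rpow hp0 f y (hk'.trans_le hs)) 0)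
    have hfin : C * (morreyNorm p lam f ^ p) ^ (q / p) * ENNReal.ofReal k ^ mu ≠ ∞ := by
      refine ENNReal.mul_ne_top (ENNReal.mul_ne_top ENNReal.coe_ne_top
        (ENNReal.rpow_ne_top_of_nonneg (by positivity) hK)) ?_
      simp [ENNReal.rpow_eq_top_iff, hk.ne']
    have h2 := ae_lt_top (hmeas.enorm.pow_const q) (ne_top_of_le_ne_top hfin h)
    filter_upwards [h2] with x hx
    exact (ENNReal.rpow_lt_top_iff_of_pos hq0).1 hx
  have := (ae_restrict_iUnion_iff _ _).2 hball
  rwa [iUnion_ball_nat, Measure.restrict_univ] at this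

/-- An operator that is dominated by the Riesz potential is bounded between the vanishing Morrey
spaces. -/
theorem boundedOnVanishingMorrey_of_le_rieszLIntegral [TopologicalSpace F]
    (hα : 0 < α) (hp : 1 < p) (hlam : 0 ≤ lam) (hlam_lt : lam < n - α * p)
    (hq : 1 / q = 1 / p - α / n) (hq0 : 0 < q) (hmu : lam / p = mu / q)
    {T : (EuclideanSpace ℝ (Fin n) → ℂ) → EuclideanSpace ℝ (Fin n) → F} {A : ℝ≥0}
    (hT : ∀ f, AEStronglyMeasurable f volume → AEStronglyMeasurable (T f) volume)
    (hA : ∀ f, ∀ᵐ x, ‖T f x‖ₑ ≤ A * rieszLIntegral volume α (fun y ↦ ‖f y‖ₑ) x) :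
    BoundedOnVanishingMorrey T p lam q mu := by
  have hp0 : 0 < p := by linarith
  obtain ⟨C, hC⟩ := exists_morreyModular_rieszLIntegral_le hα hp hlam hlam_lt hq hmu
  have key : ∀ f : EuclideanSpace ℝ (Fin n) → ℂ, AEStronglyMeasurable f volume →
      ∀ (K : ℝ≥0∞) (r : ℝ), K ≠ ∞ → 0 < r → (∀ y s, r ≤ s → morreyModular p lam f y s ≤ K) →
      ∀ x, morreyModular q mu (T f) x r ≤ ((A ^ q * C : ℝ≥0) : ℝ≥0∞) * K ^ (q / p) := by
    intro f hf K r hK hr h x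
    refine (morreyModular_le_mul_of_ae_le
      (g := rieszLIntegral volume α fun y ↦ ‖f y‖ₑ) hq0.le (hA f) x r).trans ?_
    rw [ENNReal.coe_mul, ENNReal.coe_rpow_of_nonneg _ hq0.le, mul_assoc]
    gcongr
    exact hC f hf K r hK hr h x
  set B : ℝ≥0 := A ^ q * C
  refine ⟨B ^ (1 / q), fun f hf ↦ ?_⟩
  have hK : morreyNorm p lam f ^ p ≠ ∞ := ENNReal.rpow_ne_top_of_nonneg hp0.le hf.1.2.ne
  have hnorm : morreyNorm q mu (T f) ≤ ((B ^ (1 / q) : ℝ≥0) : ℝ≥0∞) * morreyNorm p lam f := by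
    refine (morreyNorm_le_of_forall_morreyModular_le hq0 fun x r hr ↦
      key f hf.1.1 _ r hK hr (fun y s hs ↦
        morreyModular_le_morreyNorm_rpow hp0 f y (hr.trans_le hs)) x).trans_eq ?_
    have e : p * (q / p * (1 / q)) = 1 := by field_simp
    rw [ENNReal.mul_rpow_of_nonneg _ _ (by positivity), ← ENNReal.rpow_mul, ← ENNReal.rpow_mul,
      e, ENNReal.rpow_one, ENNReal.coe_rpow_of_nonneg _ (by positivity)]
  refine ⟨⟨⟨hT f hf.1.1, hnorm.trans_lt (ENNReal.mul_lt_top ENNReal.coe_lt_top hf.1.2)⟩, ?_⟩, hnorm⟩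
  -- once the modulars of `f` stay below a small `K`, those of `T f` are at most `B * K ^ (q / p)`
  rw [ENNReal.tendsto_nhds_zero]
  intro ε hε
  have hlim : Tendsto (fun K : ℝ≥0∞ ↦ B * K ^ (q / p)) (𝓝[>] 0) (𝓝 0) := by
    have h1 := (ENNReal.continuous_rpow_const (y := q / p)).tendsto 0
    rw [ENNReal.zero_rpow_of_pos (by positivity)] at h1
    have h2 := ENNReal.Tendsto.const_mul (a := (B : ℝ≥0∞)) h1 (Or.inr ENNReal.coe_ne_top)
    rw [mul_zero] at h2
    exact h2.mono_left nhdsWithin_le_nhds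
  obtain ⟨K, hKε, hK0, hKtop⟩ := ((hlim.eventually (ge_mem_nhds hε)).and
    (eventually_mem_nhdsWithin.and (eventually_nhdsWithin_of_eventually_nhds
      (gt_mem_nhds ENNReal.zero_lt_top)))).exists
  obtain ⟨R, hR⟩ := eventually_atTop.1 ((ENNReal.tendsto_nhds_zero.1 hf.2) K hK0)
  filter_upwards [eventually_ge_atTop R, eventually_gt_atTop 0] with r hrR hr0
  refine iSup_le fun x ↦ (key f hf.1.1 K r (ne_of_lt hKtop) hr0 (fun y s hs ↦ ?_) x).trans hKε
  exact (le_iSup (fun y ↦ morreyModular p lam f y s) y).trans (hR s (hrR.trans hs))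

end Riesz

end Morrey

/-! ### Domination of the four operators by the Riesz potential -/

section Domination

open Metric Module

variable {n : ℕ} {α : ℝ}

lemma enorm_ofReal_norm_rpow {E : Type*} [NormedAddCommGroup E] {z : E} (hz : z ≠ 0) (c : ℝ) :
    ‖((‖z‖ ^ c : ℝ) : ℂ)‖ₑ = ‖z‖ₑ ^ c := by
  have hz' : 0 < ‖z‖ := norm_pos_iff.2 hz
  rw [← ofReal_norm, Complex.norm_real, Real.norm_of_nonneg (by positivity),
    ← ENNReal.ofReal_rpow_of_pos hz', ofReal_norm]

/-- At `z = 0` the left side is `0` by the convention for division. -/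
lemma enorm_div_ofReal_norm_rpow_le {E : Type*} [NormedAddCommGroup E] (a : ℂ) (z : E) {c : ℝ}
    (hc : c ≠ 0) : ‖a / ((‖z‖ ^ c : ℝ) : ℂ)‖ₑ ≤ ‖a‖ₑ * ‖z‖ₑ ^ (-c) := by
  rcases eq_or_ne z 0 with rfl | hz
  · simp [Real.zero_rpow hc]
  · rw [div_eq_mul_inv, ← Complex.ofReal_inv, ← Real.rpow_neg (norm_nonneg z), enorm_mul,
      enorm_ofReal_norm_rpow hz]

lemma rpow_neg_le_rpow_neg {a b : ℝ≥0∞} {c : ℝ} (hc : 0 ≤ c) (h : b ≤ a) :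
    a ^ (-c) ≤ b ^ (-c) := by
  rw [ENNReal.rpow_neg, ENNReal.rpow_neg]
  exact ENNReal.inv_le_inv.2 (ENNReal.rpow_le_rpow h hc)

lemma rpow_le_two_rpow_mul_rpow {a b : ℝ≥0∞} {c : ℝ} (hc : 0 ≤ c) (h : b ≤ 2 * a) :
    a ^ (-c) ≤ 2 ^ c * b ^ (-c) := by
  calc a ^ (-c) = 2 ^ c * (2 * a) ^ (-c) := by
        rw [ENNReal.rpow_neg (2 * a), ENNReal.mul_rpow_of_nonneg _ _ hc, ENNReal.mul_inv,
          ← mul_assoc, ENNReal.mul_inv_cancel, one_mul, ENNReal.rpow_neg]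
        · simp [ENNReal.rpow_eq_zero_iff]
        · simp [ENNReal.rpow_eq_top_iff]
        · exact Or.inl (by simp [ENNReal.rpow_eq_zero_iff])
        · exact Or.inl (by simp [ENNReal.rpow_eq_top_iff])
    _ ≤ 2 ^ c * b ^ (-c) := by
        gcongr 2 ^ c * ?_
        exact rpow_neg_le_rpow_neg hc h

lemma lintegral_enorm_div_le_rieszLIntegral (hα : α < n) (f : EuclideanSpace ℝ (Fin n) → ℂ)
    (x : EuclideanSpace ℝ (Fin n)) :
    ∫⁻ y, ‖f y / ((‖x - y‖ ^ ((n : ℝ) - α) : ℝ) : ℂ)‖ₑ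
      ≤ rieszLIntegral volume α (fun y ↦ ‖f y‖ₑ) x := by
  refine lintegral_mono fun y ↦ ?_
  rw [finrank_euclideanSpace_fin, ← neg_sub (n : ℝ) α]
  exact enorm_div_ofReal_norm_rpow_le _ _ (by linarith)

lemma enorm_rieszPotential_le (hα : α < n) (f : EuclideanSpace ℝ (Fin n) → ℂ)
    (x : EuclideanSpace ℝ (Fin n)) :
    ‖rieszPotential α f x‖ₑ ≤ rieszLIntegral volume α (fun y ↦ ‖f y‖ₑ) x :=
  (enorm_integral_le_lintegral_enorm _).trans (lintegral_enorm_div_le_rieszLIntegral hα f x)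

lemma fractionalMaximal_le (hα : α < n) (hn : 0 < n) (f : EuclideanSpace ℝ (Fin n) → ℂ)
    (x : EuclideanSpace ℝ (Fin n)) :
    fractionalMaximal α f x ≤ (volume (ball (0 : EuclideanSpace ℝ (Fin n)) 1) ^
      (-(1 - α / n))) * rieszLIntegral volume α (fun y ↦ ‖f y‖ₑ) x := by
  have hn' : (0 : ℝ) < n := by exact_mod_cast hn
  have h0 : 0 ≤ 1 - α / n := by
    rw [sub_nonneg, div_le_one hn']
    exact hα.le
  have hb0 : volume (ball (0 : EuclideanSpace ℝ (Fin n)) 1) ≠ 0 :=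
    (measure_ball_pos _ _ one_pos).ne'
  have hb1 : volume (ball (0 : EuclideanSpace ℝ (Fin n)) 1) ≠ ∞ := measure_ball_lt_top.ne
  refine iSup₂_le fun t ht ↦ ?_
  have ht0 : ENNReal.ofReal t ≠ 0 := by simpa using ht
  have e : (volume (ball x t) ^ (1 - α / n))⁻¹ =
      volume (ball (0 : EuclideanSpace ℝ (Fin n)) 1) ^ (-(1 - α / n)) *
        ENNReal.ofReal t ^ (α - n) := by
    rw [addHaar_ball_eq_ofReal_rpow _ x ht, ENNReal.mul_rpow_of_nonneg _ _ h0,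
      finrank_euclideanSpace_fin, ← ENNReal.rpow_mul, ENNReal.mul_inv, ← ENNReal.rpow_neg,
      ← ENNReal.rpow_neg, mul_comm]
    · congr 2
      field_simp
      ring
    · exact Or.inl (by simp [ENNReal.rpow_eq_zero_iff, ht])
    · exact Or.inl (by simp [ENNReal.rpow_eq_top_iff, ht])
  rw [div_eq_mul_inv, e, mul_left_comm]
  gcongr
  rw [← lintegral_mul_const' _ _ (by simp [ENNReal.rpow_eq_top_iff, ht])]
  refine (setLIntegral_mono' measurableSet_ball fun y hy ↦ ?_).trans
    (setLIntegral_le_lintegral (ball x t) _)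
  rw [finrank_euclideanSpace_fin, ← neg_sub (n : ℝ) α]
  gcongr ‖f y‖ₑ * ?_
  refine rpow_neg_le_rpow_neg (by linarith) ?_
  rw [← ofReal_norm, ← dist_eq_norm, dist_comm]
  exact ENNReal.ofReal_le_ofReal (le_of_lt hy)

lemma rpow_mul_lintegral_norm_lt_le (hα : α < n) (f : EuclideanSpace ℝ (Fin n) → ℂ)
    {x : EuclideanSpace ℝ (Fin n)} (hx : x ≠ 0) :
    ‖x‖ₑ ^ (α - n) * ∫⁻ y in {y | ‖y‖ < ‖x‖}, ‖f y‖ₑ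
      ≤ 2 ^ ((n : ℝ) - α) * rieszLIntegral volume α (fun y ↦ ‖f y‖ₑ) x := by
  have hS : MeasurableSet {y : EuclideanSpace ℝ (Fin n) | ‖y‖ < ‖x‖} :=
    measurableSet_lt (by fun_prop) (by fun_prop)
  rw [← lintegral_const_mul' _ _ (by simp [ENNReal.rpow_eq_top_iff, hx]), rieszLIntegral,
    ← lintegral_const_mul' _ _ (by simp [ENNReal.rpow_eq_top_iff])]
  refine (setLIntegral_mono' hS fun y hy ↦ ?_).trans (setLIntegral_le_lintegral _ _)
  rw [finrank_euclideanSpace_fin, mul_left_comm, mul_comm, ← neg_sub (n : ℝ) α]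
  gcongr ‖f y‖ₑ * ?_
  refine rpow_le_two_rpow_mul_rpow (by linarith) ((enorm_sub_le).trans ?_)
  rw [two_mul]
  gcongr
  exact enorm_le_iff_norm_le.2 (le_of_lt hy)

lemma rpow_mul_lintegral_lt_norm_le (hα : 0 < α) (hαn : α < n) (f : EuclideanSpace ℝ (Fin n) → ℂ)
    (x : EuclideanSpace ℝ (Fin n)) :
    ‖x‖ₑ ^ α * ∫⁻ y in {y | ‖x‖ < ‖y‖}, ‖f y / ((‖y‖ ^ n : ℝ) : ℂ)‖ₑ
      ≤ 2 ^ ((n : ℝ) - α) * rieszLIntegral volume α (fun y ↦ ‖f y‖ₑ) x := by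
  have hS : MeasurableSet {y : EuclideanSpace ℝ (Fin n) | ‖x‖ < ‖y‖} :=
    measurableSet_lt (by fun_prop) (by fun_prop)
  have hn : (n : ℝ) ≠ 0 := by linarith
  rw [← lintegral_const_mul' _ _ (by finiteness), rieszLIntegral,
    ← lintegral_const_mul' _ _ (by simp [ENNReal.rpow_eq_top_iff])]
  refine (setLIntegral_mono' hS fun y hy ↦ ?_).trans (setLIntegral_le_lintegral _ _)
  have hxy : ‖x‖ₑ ≤ ‖y‖ₑ := enorm_le_iff_norm_le.2 (le_of_lt hy)
  have hy0 : ‖y‖ₑ ≠ 0 := by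
    rw [enorm_ne_zero, ← norm_pos_iff]
    exact (norm_nonneg x).trans_lt hy
  rw [finrank_euclideanSpace_fin, ← Real.rpow_natCast]
  calc ‖x‖ₑ ^ α * ‖f y / ((‖y‖ ^ (n : ℝ) : ℝ) : ℂ)‖ₑ
      ≤ ‖y‖ₑ ^ α * (‖f y‖ₑ * ‖y‖ₑ ^ (-(n : ℝ))) := by
        gcongr
        exact enorm_div_ofReal_norm_rpow_le _ _ hn
    _ = ‖f y‖ₑ * ‖y‖ₑ ^ (-(n - α)) := by
        rw [mul_left_comm, ← ENNReal.rpow_add _ _ hy0 enorm_ne_top, neg_sub, sub_eq_add_neg]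
    _ ≤ ‖f y‖ₑ * (2 ^ (n - α) * ‖x - y‖ₑ ^ (-(n - α))) := by
        gcongr ‖f y‖ₑ * ?_
        refine rpow_le_two_rpow_mul_rpow (by linarith) ((enorm_sub_le).trans ?_)
        rw [two_mul]
        gcongr
    _ = _ := by
        rw [mul_left_comm, neg_sub]

lemma enorm_hardyInner_le (hα : α < n) (f : EuclideanSpace ℝ (Fin n) → ℂ)
    {x : EuclideanSpace ℝ (Fin n)} (hx : x ≠ 0) :
    ‖hardyInner α f x‖ₑ ≤ 2 ^ ((n : ℝ) - α) * rieszLIntegral volume α (fun y ↦ ‖f y‖ₑ) x := by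
  rw [hardyInner, enorm_mul, enorm_ofReal_norm_rpow hx]
  refine le_trans ?_ (rpow_mul_lintegral_norm_lt_le hα f hx)
  gcongr
  exact enorm_integral_le_lintegral_enorm _

lemma enorm_hardyOuter_le (hα : 0 < α) (hαn : α < n) (f : EuclideanSpace ℝ (Fin n) → ℂ)
    {x : EuclideanSpace ℝ (Fin n)} (hx : x ≠ 0) :
    ‖hardyOuter α f x‖ₑ ≤ 2 ^ ((n : ℝ) - α) * rieszLIntegral volume α (fun y ↦ ‖f y‖ₑ) x := by
  rw [hardyOuter, enorm_mul, enorm_ofReal_norm_rpow hx]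
  refine le_trans ?_ (rpow_mul_lintegral_lt_norm_le hα hαn f x)
  gcongr
  exact enorm_integral_le_lintegral_enorm _

end Domination

/-! ### Measurability of the four operators -/

section Measurability

variable {n : ℕ} {f : EuclideanSpace ℝ (Fin n) → ℂ}

lemma aestronglyMeasurable_rieszPotential (α : ℝ) (hf : AEStronglyMeasurable f volume) :
    AEStronglyMeasurable (rieszPotential α f) volume := by
  have hk : Measurable fun z : EuclideanSpace ℝ (Fin n) × EuclideanSpace ℝ (Fin n) ↦
      ((‖z.1 - z.2‖ ^ ((n : ℝ) - α) : ℝ) : ℂ) := by fun_prop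
  exact (hf.comp_snd.div₀ hk.aestronglyMeasurable).integral_prod_right'

lemma aestronglyMeasurable_fractionalMaximal (α : ℝ) (f : EuclideanSpace ℝ (Fin n) → ℂ) :
    AEStronglyMeasurable (fractionalMaximal α f) volume :=
  (measurable_ballMaximal volume (1 - α / n) fun y ↦ ‖f y‖ₑ).aestronglyMeasurable

lemma aestronglyMeasurable_hardyInner (α : ℝ) (hf : AEStronglyMeasurable f volume) :
    AEStronglyMeasurable (hardyInner α f) volume := by
  have hS : MeasurableSet {z : EuclideanSpace ℝ (Fin n) × EuclideanSpace ℝ (Fin n) |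
      ‖z.2‖ < ‖z.1‖} := measurableSet_lt (by fun_prop) (by fun_prop)
  have h : AEStronglyMeasurable (fun x : EuclideanSpace ℝ (Fin n) ↦ ∫ y in {y | ‖y‖ < ‖x‖}, f y)
      volume := by
    refine (hf.comp_snd.indicator hS).integral_prod_right'.congr (Eventually.of_forall fun x ↦ ?_)
    exact integral_indicator (s := {y | ‖y‖ < ‖x‖})
      (measurableSet_lt (by fun_prop) (by fun_prop))
  have hk : Measurable fun x : EuclideanSpace ℝ (Fin n) ↦ ((‖x‖ ^ (α - (n : ℝ)) : ℝ) : ℂ) := by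
    fun_prop
  exact hk.aestronglyMeasurable.mul h

lemma aestronglyMeasurable_hardyOuter (α : ℝ) (hf : AEStronglyMeasurable f volume) :
    AEStronglyMeasurable (hardyOuter α f) volume := by
  have hS : MeasurableSet {z : EuclideanSpace ℝ (Fin n) × EuclideanSpace ℝ (Fin n) |
      ‖z.1‖ < ‖z.2‖} := measurableSet_lt (by fun_prop) (by fun_prop)
  have hk' : Measurable fun z : EuclideanSpace ℝ (Fin n) × EuclideanSpace ℝ (Fin n) ↦
      ((‖z.2‖ ^ n : ℝ) : ℂ) := by fun_prop
  have h : AEStronglyMeasurable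
      (fun x : EuclideanSpace ℝ (Fin n) ↦ ∫ y in {y | ‖x‖ < ‖y‖}, f y / ((‖y‖ ^ n : ℝ) : ℂ))
      volume := by
    refine ((hf.comp_snd.div₀ hk'.aestronglyMeasurable).indicator hS).integral_prod_right'.congr
      (Eventually.of_forall fun x ↦ ?_)
    exact integral_indicator (s := {y | ‖x‖ < ‖y‖})
      (measurableSet_lt (by fun_prop) (by fun_prop))
  have hk : Measurable fun x : EuclideanSpace ℝ (Fin n) ↦ ((‖x‖ ^ α : ℝ) : ℂ) := by
    fun_prop
  exact hk.aestronglyMeasurable.mul h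

end Measurability

/-! ### Boundedness of the operators -/

theorem mainTheorem3 (n : ℕ) (α p q lam mu : ℝ)
    (hα_pos : 0 < α) (hα_lt : α < n) (hp_one : 1 < p) (hp_lt : p < n / α)
    (hlam_nonneg : 0 ≤ lam) (hlam_lt : lam < n - α * p)
    (hq : 1 / q = 1 / p - α / n) (hmu : lam / p = mu / q) :
    -- the operators are well defined, almost everywhere, on the vanishing Morrey space
    (∀ f : EuclideanSpace ℝ (Fin n) → ℂ, MemVanishingMorrey p lam f →
      (∀ᵐ x : EuclideanSpace ℝ (Fin n),
        Integrable (fun y => f y / ((‖x - y‖ ^ ((n : ℝ) - α) : ℝ) : ℂ))) ∧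
      (∀ᵐ x : EuclideanSpace ℝ (Fin n), fractionalMaximal α f x < ∞) ∧
      (∀ᵐ x : EuclideanSpace ℝ (Fin n), IntegrableOn f {y | ‖y‖ < ‖x‖}) ∧
      (∀ᵐ x : EuclideanSpace ℝ (Fin n),
        IntegrableOn (fun y => f y / ((‖y‖ ^ n : ℝ) : ℂ)) {y | ‖x‖ < ‖y‖})) ∧
    -- and they are bounded
    BoundedOnVanishingMorrey (n := n) (rieszPotential α) p lam q mu ∧
    BoundedOnVanishingMorrey (n := n) (fractionalMaximal α) p lam q mu ∧
    BoundedOnVanishingMorrey (n := n) (hardyInner α) p lam q mu ∧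
    BoundedOnVanishingMorrey (n := n) (hardyOuter α) p lam q mu := by
  have hn' : (0 : ℝ) < n := hα_pos.trans hα_lt
  have hn : 0 < n := by exact_mod_cast hn'
  have hp0 : 0 < p := by linarith
  have hαp : p * α < n := (lt_div_iff₀ hα_pos).1 hp_lt
  have hq0 : 0 < q := by
    rw [← one_div_pos, hq, sub_pos, div_lt_div_iff₀ hn' hp0]
    linarith
  have : Nonempty (Fin n) := ⟨⟨0, hn⟩⟩
  have hx0 : ∀ᵐ x : EuclideanSpace ℝ (Fin n), x ≠ 0 := compl_mem_ae_iff.2 (measure_singleton 0)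
  have h2 : (2 : ℝ≥0∞) ^ ((n : ℝ) - α) ≠ ∞ := by simp [ENNReal.rpow_eq_top_iff]
  have hv : volume (Metric.ball (0 : EuclideanSpace ℝ (Fin n)) 1) ^ (-(1 - α / n)) ≠ ∞ := by
    simp [ENNReal.rpow_eq_top_iff, (Metric.measure_ball_pos volume
      (0 : EuclideanSpace ℝ (Fin n)) one_pos).ne', measure_ball_lt_top.ne]
  refine ⟨fun f hf ↦ ?_, ?_, ?_, ?_, ?_⟩
  · have hfin := ae_rieszLIntegral_lt_top hα_pos hp_one hlam_nonneg hlam_lt hq hq0 hmu hf.1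
    have hfm := hf.1.1
    refine ⟨?_, ?_, ?_, ?_⟩
    · filter_upwards [hfin] with x hx
      have hk : Measurable fun y : EuclideanSpace ℝ (Fin n) ↦
        ((‖x - y‖ ^ ((n : ℝ) - α) : ℝ) : ℂ) := by fun_prop
      exact ⟨hfm.div₀ hk.aestronglyMeasurable,
        (lintegral_enorm_div_le_rieszLIntegral hα_lt f x).trans_lt hx⟩
    · filter_upwards [hfin] with x hx
      exact (fractionalMaximal_le hα_lt hn f x).trans_lt (ENNReal.mul_lt_top hv.lt_top hx)
    · filter_upwards [hfin, hx0] with x hx hx0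
      refine ⟨hfm.restrict, ENNReal.lt_top_of_mul_ne_top_right ((rpow_mul_lintegral_norm_lt_le
        hα_lt f hx0).trans_lt (ENNReal.mul_lt_top h2.lt_top hx)).ne ?_⟩
      simp [ENNReal.rpow_eq_zero_iff, hx0]
    · filter_upwards [hfin, hx0] with x hx hx0
      have hk : Measurable fun y : EuclideanSpace ℝ (Fin n) ↦ ((‖y‖ ^ n : ℝ) : ℂ) := by fun_prop
      refine ⟨(hfm.div₀ hk.aestronglyMeasurable).restrict,
        ENNReal.lt_top_of_mul_ne_top_right ((rpow_mul_lintegral_lt_norm_le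
        hα_pos hα_lt f x).trans_lt (ENNReal.mul_lt_top h2.lt_top hx)).ne ?_⟩
      simp [ENNReal.rpow_eq_zero_iff, hx0]
  · refine boundedOnVanishingMorrey_of_le_rieszLIntegral (A := 1) hα_pos hp_one hlam_nonneg hlam_lt
      hq hq0 hmu (fun f hf ↦ aestronglyMeasurable_rieszPotential α hf)
      (fun f ↦ Eventually.of_forall fun x ↦ ?_)
    rw [ENNReal.coe_one, one_mul]
    exact enorm_rieszPotential_le hα_lt f x
  · refine boundedOnVanishingMorrey_of_le_rieszLIntegral (A := ENNReal.toNNReal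
      (volume (Metric.ball (0 : EuclideanSpace ℝ (Fin n)) 1) ^ (-(1 - α / n)))) hα_pos hp_one
      hlam_nonneg hlam_lt hq hq0 hmu (fun f _ ↦ aestronglyMeasurable_fractionalMaximal α f)
      (fun f ↦ Eventually.of_forall fun x ↦ ?_)
    exact (fractionalMaximal_le hα_lt hn f x).trans_eq (by rw [ENNReal.coe_toNNReal hv])
  · refine boundedOnVanishingMorrey_of_le_rieszLIntegral
      (A := (2 ^ ((n : ℝ) - α) : ℝ≥0∞).toNNReal) hα_pos hp_one hlam_nonneg hlam_lt hq hq0 hmu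
      (fun f hf ↦ aestronglyMeasurable_hardyInner α hf)
      (fun f ↦ hx0.mono fun x hx ↦ ?_)
    exact (enorm_hardyInner_le hα_lt f hx).trans_eq (by rw [ENNReal.coe_toNNReal h2])
  · refine boundedOnVanishingMorrey_of_le_rieszLIntegral
      (A := (2 ^ ((n : ℝ) - α) : ℝ≥0∞).toNNReal) hα_pos hp_one hlam_nonneg hlam_lt hq hq0 hmu
      (fun f hf ↦ aestronglyMeasurable_hardyOuter α hf)
      (fun f ↦ hx0.mono fun x hx ↦ ?_)
    exact (enorm_hardyOuter_le hα_pos hα_lt f hx).trans_eq (by rw [ENNReal.coe_toNNReal h2])
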